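/- **Theorem (Traczyk).** Let $D$ be a (non-empty) diagram of an oriented link on $S^2=\mathbb R^2\cup\{\infty\}$, i.e. a regular projection with over/under information; a crossing is *positive* if, with both strands directed upwards, the over-strand runs from lower left to upper right, and *negative* otherwise ($\mathrm{sgn}(p)=\pm1$). Let $c_\pm$ be the number of positive/negative crossings and $w=c_+-c_-$. For a crossing $p$ let $D^p_0$ be the diagram in which $p$ is smoothed according to the orientation; $p$ is *nugatory* if the projection of $D^p_0$ has more connected components than that of $D$, and $D$ is *reduced* if no crossing is nugatory. *Signature.* Color the regions of the complement of the projection black and white in checkerboard fashion. For a crossing $p$ let $\eta(p)=1$ if turning the over-strand counterclockwise sweeps the black regions at $p$, and $\eta(p)=-1$ otherwise; $p$ is of *type II* if the black regions at $p$ are the one between the two outgoing ends and the one between the two incoming ends. Let $X_0,\dots,X_n$ be the white regions, let $g_{ij}=-\sum\eta(p)$ for $i\ne j$, over the crossings at which $X_i$ and $X_j$ meet, $g_{ii}=-\sum_{k\ne i}g_{ik}$, and $G=(g_{ij})_{i,j=1}^n$. Then $\sigma(D)=\sigma(G)-\sum_{p\text{ of type II}}\eta(p)$, where $\sigma(G)$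 is the signature of the real symmetric matrix $G$. The results below hold for every choice of the checkerboard coloring and of $X_0$ (for $D$ as well as for $D^p_0$). *State circles and Seifert graph.* Let $D_{s_+}$ (resp. $D_{s_-}$) be the system of circles obtained by smoothing every crossing so that the two regions swept when the over-strand is turned counterclockwise (resp. clockwise) are joined, and $|D_{s_\pm}|$ the number of its circles. The Seifert graph $\Gamma(D)$ has the Seifert circles (obtained by smoothing all crossings according to the orientation) as vertices and the crossings, with their signs, as edges, each joining the two Seifert circles that meet at it. Suppose that $D$ is alternating and reduced. Then: 1. $\sigma(D)=-w+d_+-d_-$, where $d_+$ and $d_-$ are the numbers of positive and negative edges of any spanning tree of $\Gamma(D)$ (of any maximal spanning forest, if $D$ is not connected). 2. $\sigma(D)=-\tfrac12\bigl(w-|D_{s_+}|+|D_{s_-}|\bigr)$. If $D$ is connected, also $\sigma(D)=-\tfrac12 w+\tfrac12(W-B)$, where $W$ and $B$ are the numbers of white and black regions of a standard shading, i.e. a checkerboard coloring in which at every crossing the regions swept when the over-strand is turned counterclockwise are black. 3. $\sigma(D)=\sigma(D^p_0)-\mathrm{sgn}(p)$ for every crossing $p$ of $D$. -/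

import Mathlib

/-- Combinatorial data of an oriented link diagram on the sphere `S²` (the plane together with the
point at infinity).

`S` is the set of *passages*: the moments at which the oriented link, when traversed, runs through
a vertex of its projection.  A vertex is either a crossing, which has two passages (over and under),
or a plain bivalent point, which has one (for instance the projection of a vertex of a polygonal
link; a crossingless circle is a component that carries plain points only).

The arcs of the diagram are also indexed by `S`: arc `s` leaves passage `s` and enters passage
`next s`.  `R` is the set of regions of the complement of the projection, and `left s`, `right s`
are the regions on the two sides of arc `s`.  That these data are those of a diagram on the sphere
is the predicate `LinkDiagram.IsPlanar` below. -/
structure LinkDiagram (S R : Type*) where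
  /-- the passage that follows along the oriented link -/
  next : Equiv.Perm S
  /-- the other passage at the same crossing; `mate s = s` at a plain point -/
  mate : S → S
  mate_mate : ∀ s, mate (mate s) = s
  /-- is this passage the overpass? (meaningless at plain points) -/
  isOver : S → Bool
  isOver_mate : ∀ s, mate s ≠ s → isOver (mate s) = !isOver s
  /-- the sign of the crossing (meaningless at plain points) -/
  sign : S → ℤˣ
  sign_mate : ∀ s, sign (mate s) = sign s
  /-- the region to the left of the arc from `s` to `next s` -/
  left : S → R
  /-- the region to the right of the arc from `s` to `next s` -/
  right : S → R

namespace LinkDiagram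

variable {S R : Type*} (D : LinkDiagram S R)

/-! ### Crossings, writhe, connected components -/

/-- The crossings, each represented by its over-passage. -/
def Crossing : Type _ := {s : S // D.mate s ≠ s ∧ D.isOver s = true}

noncomputable instance [Finite S] : Fintype D.Crossing :=
  @Fintype.ofFinite D.Crossing (Subtype.finite (p := fun s => D.mate s ≠ s ∧ D.isOver s = true))

/-- The plain points. -/
def Point : Type _ := {s : S // D.mate s = s}

variable {D}

/-- The over-passage of a crossing. -/
def Crossing.o (c : D.Crossing) : S := c.1

/-- The under-passage of a crossing. -/
def Crossing.u (c : D.Crossing) : S := D.mate c.1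

/-- The sign `sgn(c)` of a crossing: with both strands directed upwards, `1` if the over-strand
runs from lower left to upper right and `-1` if it runs from lower right to upper left. -/
def Crossing.sgn (c : D.Crossing) : ℤˣ := D.sign c.1

variable (D)

/-- The arc that enters the passage `s`. -/
def inArc (s : S) : S := D.next.symm s

/-- The writhe `w = c₊ - c₋`. -/
noncomputable def writhe [Finite S] : ℤ := ∑ c : D.Crossing, (c.sgn : ℤ)

/-- The connected components of the projection, as a planar graph. -/
def Component : Type _ := Quot fun s t : S => t = D.next s ∨ t = D.mate s

/-- The projection is connected (and non-empty). -/
def Connected : Prop := Nat.card D.Component = 1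

/-! ### The four corners of a crossing

Turn a crossing so that both strands are directed upwards.  One of them, `rise`, runs from lower
left to upper right, and the other, `fall`, from lower right to upper left. -/

section corners
variable {D}

def Crossing.rise (c : D.Crossing) : S := if c.sgn = 1 then c.o else c.u
def Crossing.fall (c : D.Crossing) : S := if c.sgn = 1 then c.u else c.o

/-- The region between the two outgoing ends. -/
def Crossing.north (c : D.Crossing) : R := D.left c.rise
/-- The region between the two incoming ends. -/
def Crossing.south (c : D.Crossing) : R := D.right (D.inArc c.rise)
/-- The region to the left of both strands. -/
def Crossing.west (c : D.Crossing) : R := D.left c.fall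
/-- The region to the right of both strands. -/
def Crossing.east (c : D.Crossing) : R := D.right c.rise

end corners

/-- The data come from a link diagram drawn on the sphere.

* At plain points and around crossings the labels `left`, `right` agree, that is, they are constant
  along the boundary walks of the faces.
* Every region occurs and the sphere is connected: one can get from any arc to any other by moving
  inside the projection and across regions.
* Euler's formula `V - E + F = 1 + C` for a graph with `C` connected components on the sphere.

(A labelling with the first two properties satisfies `V - E + F ≤ 1 + C`, with equality if and only
if all connected components of the projection have genus zero and they are nested without cycles,
i.e. if and only if the data are those of a drawing on the sphere.) -/
structure IsPlanar : Prop where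
  point_left : ∀ s, D.mate s = s → D.left (D.inArc s) = D.left s
  point_right : ∀ s, D.mate s = s → D.right (D.inArc s) = D.right s
  corner_north : ∀ c : D.Crossing, D.right c.fall = c.north
  corner_south : ∀ c : D.Crossing, D.left (D.inArc c.fall) = c.south
  corner_west : ∀ c : D.Crossing, D.left (D.inArc c.rise) = c.west
  corner_east : ∀ c : D.Crossing, D.right (D.inArc c.fall) = c.east
  surj : ∀ X : R, ∃ s, D.left s = X ∨ D.right s = X
  sphere_connected : ∀ s t : S, Relation.EqvGen
    (fun a b => b = D.next a ∨ b = D.mate a ∨ D.left a = D.left b ∨ D.left a = D.right b ∨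
      D.right a = D.right b) s t
  euler : ((Nat.card D.Crossing + Nat.card D.Point : ℕ) : ℤ) - Nat.card S + Nat.card R
    = 1 + Nat.card D.Component

/-! ### Alternating and reduced diagrams, smoothing a crossing -/

/-- Along the link, over- and under-passages of crossings alternate. -/
def IsAlternating : Prop :=
  ∀ (s : S) (n : ℕ), 0 < n → D.mate s ≠ s →
    (∀ k, 0 < k → k < n → D.mate ((D.next ^ k) s) = (D.next ^ k) s) →
    D.mate ((D.next ^ n) s) ≠ (D.next ^ n) s → D.isOver ((D.next ^ n) s) ≠ D.isOver s

open Classical in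
/-- The diagram `D^p_0`: the crossing `p` is smoothed according to the orientation.  The strand
that arrives on the under-passage now leaves along the outgoing over-arc and vice versa, so that the
crossing is replaced by two plain points, and the regions to the north and to the south of `p`
become one region.  Arcs keep their names. -/
noncomputable def smooth (p : D.Crossing) :
    LinkDiagram S (Quot fun X Y : R => X = p.north ∧ Y = p.south) where
  next := D.next.trans (Equiv.swap p.o p.u)
  mate := fun s => if s = p.o ∨ s = p.u then s else D.mate s
  mate_mate := by
    intro s
    have h1 : D.mate p.o = p.u := rfl
    have h2 : D.mate p.u = p.o := D.mate_mate p.o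
    by_cases h : s = p.o ∨ s = p.u
    · simp [h]
    · have h' : ¬ (D.mate s = p.o ∨ D.mate s = p.u) := by
        rintro (h3 | h3)
        · exact h (Or.inr (by rw [← h1, ← h3, D.mate_mate]))
        · exact h (Or.inl (by rw [← h2, ← h3, D.mate_mate]))
      simp [h, h', D.mate_mate]
  isOver := D.isOver
  isOver_mate := by
    intro s hs
    by_cases h : s = p.o ∨ s = p.u
    · simp [h] at hs
    · simp only [h, if_false] at hs ⊢
      exact D.isOver_mate s hs
  sign := D.sign
  sign_mate := by
    intro s
    by_cases h : s = p.o ∨ s = p.u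
    · simp [h]
    · simp only [h, if_false]
      exact D.sign_mate s
  left := fun s => Quot.mk _ (D.left s)
  right := fun s => Quot.mk _ (D.right s)

/-- A crossing is nugatory if smoothing it increases the number of connected components of the
projection. -/
def IsNugatory (p : D.Crossing) : Prop :=
  Nat.card D.Component < Nat.card (D.smooth p).Component

/-- No crossing is nugatory. -/
def IsReduced : Prop := ∀ p : D.Crossing, ¬ D.IsNugatory p

/-! ### Kauffman states -/

/-- The arcs `a`, `b` are joined at a vertex after all crossings have been smoothed according to the
markers `m`.  The positive marker joins the two regions that are swept when the over-strand is
turned counterclockwise.  Hence a marker equal to the sign of the crossing gives the smoothing that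
agrees with the orientation (joining north and south), and a marker opposite to the sign the other
one (joining west and east). -/
def Joined (m : D.Crossing → ℤˣ) (a b : S) : Prop :=
  (∃ s, D.mate s = s ∧ a = D.inArc s ∧ b = s) ∨
  (∃ c : D.Crossing, m c = c.sgn ∧
    (a = D.inArc c.o ∧ b = c.u ∨ a = D.inArc c.u ∧ b = c.o)) ∨
  (∃ c : D.Crossing, m c ≠ c.sgn ∧
    (a = D.inArc c.o ∧ b = D.inArc c.u ∨ a = c.o ∧ b = c.u))

/-- The circles of `D_m`. -/
def StateCircle (m : D.Crossing → ℤˣ) : Type _ := Quot (D.Joined m)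

/-- `|D_{s₊}|`, all markers positive. -/
noncomputable def numPlusCircles : ℕ := Nat.card (D.StateCircle fun _ => 1)

/-- `|D_{s₋}|`, all markers negative. -/
noncomputable def numMinusCircles : ℕ := Nat.card (D.StateCircle fun _ => -1)

/-! ### The Seifert graph

Its vertices are the Seifert circles, its edges the crossings (with their signs). -/

/-- The Seifert circles: all crossings are smoothed according to the orientation. -/
def SeifertCircle : Type _ := D.StateCircle fun c => c.sgn

section seifert
variable {D}

/-- The two ends in the Seifert graph of the edge given by a crossing. -/
def Crossing.end₁ (c : D.Crossing) : D.SeifertCircle := Quot.mk _ c.o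
def Crossing.end₂ (c : D.Crossing) : D.SeifertCircle := Quot.mk _ c.u

end seifert

/-- Two vertices of the Seifert graph are connected by a path with edges in `T`. -/
def Reach (T : Set D.Crossing) : D.SeifertCircle → D.SeifertCircle → Prop :=
  Relation.EqvGen fun v w => ∃ c ∈ T, c.end₁ = v ∧ c.end₂ = w

/-- `T` is the edge set of a spanning forest of the Seifert graph: it connects any two vertices
that are connected in the graph, and it has no cycles (every edge of `T` is a bridge of `T`).  If the
Seifert graph is connected, this is a spanning tree. -/
def IsSpanningForest (T : Finset D.Crossing) : Prop :=
  (∀ v w, D.Reach Set.univ v w → D.Reach (T : Set D.Crossing) v w) ∧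
  ∀ c ∈ T, ¬ D.Reach {c' | c' ∈ T ∧ c' ≠ c} c.end₁ c.end₂

/-- The number `d₊` of positive edges. -/
def dPlus (T : Finset D.Crossing) : ℕ := (T.filter fun c => c.sgn = 1).card

/-- The number `d₋` of negative edges. -/
def dMinus (T : Finset D.Crossing) : ℕ := (T.filter fun c => c.sgn = -1).card

/-! ### Checkerboard colorings, Goeritz matrix and signature -/

/-- `χ` (with `true` for black and `false` for white) is a checkerboard coloring of the regions. -/
def IsCheckerboard (χ : R → Bool) : Prop := ∀ s, χ (D.left s) ≠ χ (D.right s)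

/-- The white regions. -/
def White (χ : R → Bool) : Type _ := {X : R // χ X = false}

/-- The black regions. -/
def Black (χ : R → Bool) : Type _ := {X : R // χ X = true}

section goeritz
variable {D}

/-- One of the two regions at `c` that are swept when the over-strand is turned counterclockwise
(the other one is opposite to it). -/
def Crossing.swept (c : D.Crossing) : R := if c.sgn = 1 then c.north else c.west

/-- The incidence number `η(c)`: it is `1` if turning the over-strand counterclockwise sweeps the
black regions, `-1` if it sweeps the white ones. -/
def Crossing.eta (χ : R → Bool) (c : D.Crossing) : ℤ := if χ c.swept = true then 1 else -1

/-- `c` is of type II if the black regions at `c` are north and south, i.e. if the orientation of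
the strands is not induced by an orientation of the black surface at `c`. -/
def Crossing.IsTypeII (χ : R → Bool) (c : D.Crossing) : Prop := χ c.north = true

/-- The crossing `c` connects the white regions `X` and `Y`: they are the two white corners. -/
def Crossing.Connects (χ : R → Bool) (c : D.Crossing) (X Y : White χ) : Prop :=
  if χ c.north = true
  then (X.1 = c.west ∧ Y.1 = c.east ∨ X.1 = c.east ∧ Y.1 = c.west)
  else (X.1 = c.north ∧ Y.1 = c.south ∨ X.1 = c.south ∧ Y.1 = c.north)

end goeritz

noncomputable instance [Finite R] (χ : R → Bool) : Fintype (White χ) :=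
  @Fintype.ofFinite (White χ) (Subtype.finite (p := fun X => χ X = false))

open Classical in
/-- The off-diagonal entry `- ∑ η(c)`, over the crossings that connect `X` and `Y`. -/
noncomputable def goeritzEntry [Finite S] (χ : R → Bool) (X Y : White χ) : ℤ :=
  - ∑ c : D.Crossing, if c.Connects χ X Y then c.eta χ else 0

open Classical in
/-- The unreduced Goeritz matrix `G'`. -/
noncomputable def unreducedGoeritz [Finite S] [Finite R] (χ : R → Bool) :
    Matrix (White χ) (White χ) ℤ := fun X Y =>
  if X = Y then - ∑ Z ∈ Finset.univ.erase X, D.goeritzEntry χ X Z else D.goeritzEntry χ X Y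

/-- The Goeritz matrix `G`: the row and the column of the white region `X₀` are removed. -/
noncomputable def goeritz [Finite S] [Finite R] (χ : R → Bool) (X₀ : White χ) :
    Matrix {X : White χ // X ≠ X₀} {X : White χ // X ≠ X₀} ℤ :=
  (D.unreducedGoeritz χ).submatrix Subtype.val Subtype.val

open Classical in
/-- The correction term `μ`, the sum of `η` over the crossings of type II. -/
noncomputable def mu [Finite S] (χ : R → Bool) : ℤ :=
  ∑ c : D.Crossing, if c.IsTypeII χ then c.eta χ else 0

open Classical in
/-- The signature of a symmetric integral matrix, regarded as a real quadratic form. -/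
noncomputable def _root_.Matrix.intSignature {n : Type*} [Fintype n] (M : Matrix n n ℤ) : ℤ :=
  (sigPos (M.map (Int.cast : ℤ → ℝ)).toQuadraticForm' : ℤ) -
    (sigNeg (M.map (Int.cast : ℤ → ℝ)).toQuadraticForm' : ℤ)

open Classical in
/-- The signature `σ(D) = σ(G) - μ`, computed from a checkerboard coloring `χ` with the white
region `X₀` as the unbounded one. -/
noncomputable def signature [Finite S] [Finite R] (χ : R → Bool) (X₀ : White χ) : ℤ :=
  (D.goeritz χ X₀).intSignature - D.mu χ

/-- The standard shading of an alternating diagram: a checkerboard coloring in which, at every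
crossing, turning the over-strand counterclockwise sweeps the black regions. -/
def IsStandardShading (χ : R → Bool) : Prop :=
  D.IsCheckerboard χ ∧ ∀ c : D.Crossing, χ c.swept = true

end LinkDiagram

/-! Everything reduces to counting state circles. For a checkerboard coloring the Goeritz form is
the sum over the crossings of η(c)(x(X) - x(Y))², where X and Y are the white corners of c and the
potential x vanishes at X₀ (`IsLabelling.goeritz_form`). In an alternating diagram η is constant on
each component of the projection (`IsAlternating.isPolarization`), so the positive and the negative
squares live on disjoint unions of components. Their ranks add up to the total rank, and the
signature is the difference of the ranks (`sigPos_eq_of_sum_squares`). On a union of components the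
rank is the number of circles along white regions minus the number of components
(`IsPlanar.intSignature_goeritz`).

Planarity enters through two opposite inequalities. Write c, C, R for the numbers of crossings,
components and regions, and s, s' for the numbers of circles of the two states that join the black
and the white regions. Modulo two, the circles of opposite states span spaces of cycles that meet
only in functions constant on components, so s + s' ≤ c + 2C (`card_quot_add_card_quot_le`). The
graph with the regions and components as vertices and all these circles as edges is connected, so R
+ C ≤ s + s' + 1. Euler's formula R = 1 + C + c makes both sharp, also on every union of components
(`IsPlanar.genus_eq`). Hence 2σ = -w + |D_{s₊}| - |D_{s₋}|, while |D_{s₊}| + |D_{s₋}| = c + 2C.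

For spanning forests, the cycle inequality is applied to the diagram in which all crossings of sign
other than ε are smoothed along the orientation. Together with rank bounds for the forest it gives a
chain of inequalities which the circle sum forces to be equalities. For a smoothed crossing p that
is not nugatory, the diagram stays planar with the same C. One extreme state is unchanged, so by the
circle sum the other loses one circle, and w changes by sgn(p). -/

open Module

/-! ### Signatures of signed sums of squares -/

section signature

variable {M ι : Type*} [AddCommGroup M] [Module ℝ M]

/-- The coordinates of a vector-valued linear map that satisfy a predicate. -/
def LinearMap.coordsOn (d : M →ₗ[ℝ] (ι → ℝ)) (p : ι → Prop) : M →ₗ[ℝ] ({i // p i} → ℝ) :=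
  LinearMap.funLeft ℝ ℝ Subtype.val ∘ₗ d

lemma LinearMap.mem_ker_coordsOn {d : M →ₗ[ℝ] (ι → ℝ)} {p : ι → Prop} {x : M} :
    x ∈ LinearMap.ker (d.coordsOn p) ↔ ∀ i, p i → d x i = 0 := by
  simp [LinearMap.coordsOn, funext_iff, LinearMap.funLeft_apply]

-- On the common kernel of the positive coordinates Q is nonpositive, which bounds `sigPos` above by
-- `a`. On the common kernel of the negative ones, cut down to a complement of the kernel of `d`, it
-- is positive definite; the dimension there is at least `a` because `a + b` does not exceed the
-- rank of `d`.
open Classical in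
theorem sigPos_eq_of_sum_squares [FiniteDimensional ℝ M] [Fintype ι] (d : M →ₗ[ℝ] (ι → ℝ))
    (p : ι → Prop) (Q : QuadraticForm ℝ M)
    (hQ : ∀ x, Q x = ∑ i, if p i then d x i ^ 2 else - d x i ^ 2) {a b : ℕ}
    (ha : finrank ℝ (LinearMap.range (d.coordsOn p)) ≤ a)
    (hb : finrank ℝ (LinearMap.range (d.coordsOn fun i => ¬ p i)) ≤ b)
    (hab : a + b ≤ finrank ℝ (LinearMap.range d)) : sigPos Q = a := by
  have e := d.finrank_range_add_finrank_ker
  have ep := (d.coordsOn p).finrank_range_add_finrank_ker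
  have en := (d.coordsOn fun i => ¬ p i).finrank_range_add_finrank_ker
  apply le_antisymm
  · have h := QuadraticForm.sigPos_add_finrank_le_of_nonpos (Q := Q)
      (V := LinearMap.ker (d.coordsOn p)) (fun x hx => by
        rw [LinearMap.mem_ker_coordsOn] at hx
        rw [hQ]
        refine Finset.sum_nonpos fun i _ => ?_
        split_ifs with h
        · simp [hx i h]
        · simpa using sq_nonneg (d x i))
    omega
  · obtain ⟨C, hC⟩ := Submodule.exists_isCompl (LinearMap.ker d)
    set N := LinearMap.ker (d.coordsOn fun i => ¬ p i)
    have hle : LinearMap.ker d ≤ N := fun x hx => by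
      rw [LinearMap.mem_ker_coordsOn]
      intro i _
      rw [LinearMap.mem_ker.1 hx, Pi.zero_apply]
    have h1 : LinearMap.ker d ⊔ C ⊓ N = N := by
      rw [← sup_inf_assoc_of_le _ hle, hC.sup_eq_top, top_inf_eq]
    have h2 : LinearMap.ker d ⊓ (C ⊓ N) = ⊥ := by
      rw [← inf_assoc, hC.inf_eq_bot, bot_inf_eq]
    have h3 := Submodule.finrank_sup_add_finrank_inf_eq (LinearMap.ker d) (C ⊓ N)
    rw [h1, h2, finrank_bot] at h3
    have h4 : finrank ℝ ↥(C ⊓ N) ≤ sigPos Q := by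
      apply le_sigPos_of_posDef
      rintro ⟨x, hxC, hxN⟩ hx
      rw [QuadraticMap.restrict_apply, hQ]
      replace hxN := LinearMap.mem_ker_coordsOn.1 hxN
      have hx0 : x ≠ 0 := fun h => hx (by simp [h])
      have hd : d x ≠ 0 := fun h => hx0 (by
        have : x ∈ LinearMap.ker d ⊓ C := ⟨h, hxC⟩
        rwa [hC.inf_eq_bot, Submodule.mem_bot] at this)
      obtain ⟨i, hi⟩ := Function.ne_iff.1 hd
      refine Finset.sum_pos' (fun j _ => ?_) ⟨i, Finset.mem_univ _, ?_⟩
      · split_ifs with h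
        · exact sq_nonneg _
        · simp [hxN j h]
      · have hp : p i := by
          by_contra h
          exact hi (hxN i h)
        rw [if_pos hp]
        exact sq_pos_of_ne_zero hi
    omega

open Classical in
theorem sigNeg_eq_of_sum_squares [FiniteDimensional ℝ M] [Fintype ι] (d : M →ₗ[ℝ] (ι → ℝ))
    (p : ι → Prop) (Q : QuadraticForm ℝ M)
    (hQ : ∀ x, Q x = ∑ i, if p i then d x i ^ 2 else - d x i ^ 2) {a b : ℕ}
    (ha : finrank ℝ (LinearMap.range (d.coordsOn p)) ≤ a)
    (hb : finrank ℝ (LinearMap.range (d.coordsOn fun i => ¬ p i)) ≤ b)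
    (hab : a + b ≤ finrank ℝ (LinearMap.range d)) : sigNeg Q = b := by
  rw [← sigPos_neg]
  refine sigPos_eq_of_sum_squares d (fun i => ¬ p i) (-Q) (fun x => ?_) hb (b := a)
    (by rwa [show (fun i => ¬ ¬ p i) = p from funext fun i => propext not_not]) (by omega)
  rw [neg_apply, hQ, ← Finset.sum_neg_distrib]
  refine Finset.sum_congr rfl fun i _ => ?_
  by_cases h : p i <;> simp [h]

end signature

/-! ### Quotients and dimensions -/

section quotients

variable {S : Type*}

/-- A predicate compatible with a relation splits the quotient. -/
theorem Nat.card_quot_split [Finite S] (r : S → S → Prop) (P : S → Prop)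
    (hP : ∀ a b, r a b → (P a ↔ P b)) :
    Nat.card (Quot r) = Nat.card (Quot fun a b : {s // P s} => r a b) +
      Nat.card (Quot fun a b : {s // ¬ P s} => r a b) := by
  classical
  rw [← Nat.card_sum]
  refine Nat.card_congr
    { toFun := Quot.lift (fun s => if h : P s then Sum.inl (Quot.mk _ ⟨s, h⟩)
          else Sum.inr (Quot.mk _ ⟨s, h⟩)) ?_
      invFun := Sum.elim (Quot.lift (fun s => Quot.mk _ s.1) fun a b h => Quot.sound h)
        (Quot.lift (fun s => Quot.mk _ s.1) fun a b h => Quot.sound h)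
      left_inv := ?_
      right_inv := ?_ }
  · intro a b h
    by_cases ha : P a
    · have hb := (hP a b h).1 ha
      simp only [ha, hb, dif_pos]
      exact congrArg _ (Quot.sound h)
    · have hb : ¬ P b := fun hb => ha ((hP a b h).2 hb)
      simp only [ha, hb, dif_neg, not_false_eq_true]
      exact congrArg _ (Quot.sound h)
  · rintro ⟨s⟩
    by_cases h : P s <;> simp [h]
  · rintro (⟨s, h⟩ | ⟨s, h⟩) <;> simp [h]

variable (K : Type*) [Field K]

/-- The functions compatible with a relation. -/
def compatible (r : S → S → Prop) : Submodule K (S → K) where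
  carrier := {f | ∀ a b, r a b → f a = f b}
  add_mem' hf hg a b h := by simp [hf a b h, hg a b h]
  zero_mem' _ _ _ := rfl
  smul_mem' k f hf a b h := by simp [hf a b h]

/-- Functions compatible with a relation are functions on the quotient. -/
def compatibleEquiv (r : S → S → Prop) : compatible K r ≃ₗ[K] (Quot r → K) where
  toFun f := Quot.lift f.1 f.2
  map_add' f g := by ext ⟨s⟩; rfl
  map_smul' k f := by ext ⟨s⟩; rfl
  invFun g := ⟨fun s => g (Quot.mk r s), fun a b h => congrArg g (Quot.sound h)⟩
  left_inv f := rfl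
  right_inv g := by ext ⟨s⟩; rfl

/-- This turns the counting of circles and components into dimension counts. -/
theorem finrank_compatible [Finite S] (r : S → S → Prop) :
    finrank K (compatible K r) = Nat.card (Quot r) := by
  have := Fintype.ofFinite (Quot r)
  rw [(compatibleEquiv K r).finrank_eq, finrank_fintype_fun_eq_card, Nat.card_eq_fintype_card]

/-- The relation whose classes are the connected components of the graph with vertices the orbits
of `τ` and edges joining `s` to `ν s`. -/
def componentRel (ν : Equiv.Perm S) (τ : S → S) (s t : S) : Prop := t = ν s ∨ t = τ s

end quotients

/-! ### The two smoothings of a graph with vertices of degree two and four -/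

section smoothings

variable {S : Type*} [Finite S]

theorem orbit_eq_iff {S : Type*} {τ : S → S} (hτ : ∀ s, τ (τ s) = s) {s t : S} :
    Quot.mk (fun s t : S => t = τ s) s = Quot.mk _ t ↔ t = s ∨ t = τ s := by
  constructor
  · intro h
    replace h := Quot.eqvGen_exact h
    induction h with
    | rel x y h => exact Or.inr h
    | refl x => exact Or.inl rfl
    | symm x y _ ih => grind
    | trans x y z _ _ ih ih' => grind
  · rintro (rfl | rfl)
    · rfl
    · exact Quot.sound rfl

/-- The orbits of an involution, counted by means of a choice of one element from each orbit of
length two. -/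
theorem card_orbits_add_card_chosen (τ : S → S) (hτ : ∀ s, τ (τ s) = s) (p : S → Prop)
    (hp : ∀ s, τ s ≠ s → (p (τ s) ↔ ¬ p s)) :
    Nat.card (Quot fun s t : S => t = τ s) + Nat.card {s // τ s ≠ s ∧ p s} = Nat.card S := by
  classical
  have hbij : Function.Bijective
      fun s : {s // ¬ (τ s ≠ s ∧ p s)} => Quot.mk (fun s t : S => t = τ s) s.1 := by
    constructor
    · rintro ⟨s, hs⟩ ⟨t, ht⟩ h
      have key := (orbit_eq_iff hτ).1 h
      apply Subtype.ext
      rcases key with rfl | rfl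
      · rfl
      · by_contra hne
        have hne' : τ s ≠ s := fun h => hne h.symm
        have h1 : ¬ p s := fun h => hs ⟨hne', h⟩
        exact ht ⟨by rw [hτ]; exact hne, (hp s hne').2 h1⟩
    · rintro ⟨s⟩
      by_cases hs : τ s ≠ s ∧ p s
      · exact ⟨⟨τ s, fun h => (hp s hs.1).1 h.2 hs.2⟩, ((orbit_eq_iff hτ).2 (Or.inr rfl)).symm⟩
      · exact ⟨⟨s, hs⟩, rfl⟩
  rw [← Nat.card_congr (Equiv.ofBijective _ hbij), add_comm, ← Nat.card_sum]
  exact Nat.card_congr (Equiv.sumCompl _)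

open Classical in
/-- Let `S` be the set of edges of a graph whose vertices are the orbits of the involution `τ`, the
edge `s` leading from the orbit of `s` to that of `ν s`.  If the functions compatible with `r` and
those compatible with `r'` are cycles modulo two, and functions compatible with both are constant on
connected components, then the numbers of classes satisfy the genus inequality. -/
theorem card_quot_add_card_quot_le (ν : Equiv.Perm S) (τ : S → S) (hτ : ∀ s, τ (τ s) = s)
    (p : S → Prop) (hp : ∀ s, τ s ≠ s → (p (τ s) ↔ ¬ p s)) (r r' : S → S → Prop)
    (hr : ∀ f ∈ compatible (ZMod 2) r, ∀ s, (τ s = s → f (ν.symm s) = f s) ∧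
      f (ν.symm s) + f s + (f (ν.symm (τ s)) + f (τ s)) = 0)
    (hr' : ∀ f ∈ compatible (ZMod 2) r', ∀ s, (τ s = s → f (ν.symm s) = f s) ∧
      f (ν.symm s) + f s + (f (ν.symm (τ s)) + f (τ s)) = 0)
    (hrr' : compatible (ZMod 2) r ⊓ compatible (ZMod 2) r' ≤
      compatible (ZMod 2) (componentRel ν τ)) :
    Nat.card (Quot r) + Nat.card (Quot r') ≤
      Nat.card {s // τ s ≠ s ∧ p s} + 2 * Nat.card (Quot (componentRel ν τ)) := by
  let K := ZMod 2
  let V := Quot fun s t : S => t = τ s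
  have := Fintype.ofFinite S
  have := Fintype.ofFinite V
  let v : S → V := Quot.mk _
  -- The incidence matrix modulo two: `A` is the coboundary and its transpose the boundary map, and
  -- a loop gets the entry 1 + 1 = 0.
  let A : Matrix S V K := fun s x => (if v s = x then 1 else 0) + (if v (ν s) = x then 1 else 0)
  have hA : ∀ g s, A.mulVec g s = g (v s) + g (v (ν s)) := by
    intro g s
    simp [A, Matrix.mulVec, dotProduct, add_mul, Finset.sum_add_distrib]
  have hAT : ∀ f s, A.transpose.mulVec f (v s) =
      ∑ t, if v t = v s then f (ν.symm t) + f t else 0 := by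
    intro f s
    have : ∑ t, (if v t = v s then f (ν.symm t) else 0) =
        ∑ t, if v (ν t) = v s then f t else 0 := by
      rw [← Equiv.sum_comp ν]
      simp
    simp_rw [← Finset.sum_filter, Finset.sum_add_distrib, Finset.sum_filter, this]
    simp only [Matrix.mulVec, dotProduct, Matrix.transpose_apply]
    simp only [A, add_mul, ite_mul, one_mul, zero_mul, Finset.sum_add_distrib]
    rw [add_comm]
  have hker : finrank K (LinearMap.ker A.mulVecLin) ≤
      Nat.card (Quot (componentRel ν τ)) := by
    rw [← finrank_compatible K]
    let φ : LinearMap.ker A.mulVecLin →ₗ[K] compatible K (componentRel ν τ) :=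
      LinearMap.codRestrict _ (LinearMap.funLeft K K v ∘ₗ Submodule.subtype _) (by
        rintro ⟨g, hg⟩ a b h
        have h0 : g (v a) + g (v (ν a)) = 0 := by
          rw [← hA]
          exact congrFun (LinearMap.mem_ker.1 hg) a
        change g (v a) = g (v b)
        rcases h with rfl | rfl
        · exact CharTwo.add_eq_zero.1 h0
        · exact congrArg g (Quot.sound rfl))
    refine LinearMap.finrank_le_finrank_of_injective (f := φ) ?_
    rintro ⟨g, hg⟩ ⟨g', hg'⟩ h
    apply Subtype.ext
    funext x
    obtain ⟨s, rfl⟩ := Quot.exists_rep x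
    exact congrFun (congrArg Subtype.val h) s
  have hmem : ∀ f : S → K, (∀ s, (τ s = s → f (ν.symm s) = f s) ∧
      f (ν.symm s) + f s + (f (ν.symm (τ s)) + f (τ s)) = 0) →
      f ∈ LinearMap.ker A.transpose.mulVecLin := by
    intro f hf
    rw [LinearMap.mem_ker]
    funext x
    obtain ⟨s, rfl⟩ := Quot.exists_rep x
    change A.transpose.mulVec f (v s) = 0
    rw [hAT, ← Finset.sum_filter]
    have hfil : Finset.univ.filter (fun t => v t = v s) = {s, τ s} := by
      ext t
      simp only [Finset.mem_filter, Finset.mem_univ, true_and, Finset.mem_insert,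
        Finset.mem_singleton]
      rw [eq_comm]
      exact orbit_eq_iff hτ
    rw [hfil]
    by_cases h : τ s = s
    · rw [h, Finset.insert_eq_of_mem (Finset.mem_singleton_self s), Finset.sum_singleton,
        (hf s).1 h, CharTwo.add_self_eq_zero]
    · rw [Finset.sum_pair (Ne.symm h), (hf s).2]
  -- Both spaces consist of cycles, and the cycle space has dimension E - V + dim ker A, where E - V
  -- is the number of orbits of length two. The intersection costs at most one further number of
  -- components.
  have hsup : compatible K r ⊔ compatible K r' ≤ LinearMap.ker A.transpose.mulVecLin :=
    sup_le (fun f hf => hmem f (hr f hf)) fun f hf => hmem f (hr' f hf)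
  have h1 := Submodule.finrank_mono hsup
  have h2 : finrank K ↥(compatible K r ⊓ compatible K r') ≤ _ := Submodule.finrank_mono hrr'
  have h3 := Submodule.finrank_sup_add_finrank_inf_eq (compatible K r) (compatible K r')
  have h4 := A.mulVecLin.finrank_range_add_finrank_ker
  have h5 := A.transpose.mulVecLin.finrank_range_add_finrank_ker
  have h6 : finrank K (LinearMap.range A.transpose.mulVecLin) =
      finrank K (LinearMap.range A.mulVecLin) := A.rank_transpose
  have h7 := card_orbits_add_card_chosen τ hτ p hp
  rw [finrank_compatible] at h2
  rw [finrank_compatible, finrank_compatible] at h3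
  rw [finrank_fintype_fun_eq_card, ← Nat.card_eq_fintype_card] at h4 h5
  change Nat.card V + _ = _ at h7
  omega

end smoothings

theorem Int.units_eq_of_ne_of_ne {a b c : ℤˣ} (h : a ≠ b) (h' : a ≠ c) : b = c := by
  revert a b c
  decide

namespace LinkDiagram

variable {S R : Type*} {D : LinkDiagram S R}

/-! ### Passages and states -/

theorem Crossing.mate_o (c : D.Crossing) : D.mate c.o = c.u := rfl

theorem Crossing.mate_u (c : D.Crossing) : D.mate c.u = c.o := D.mate_mate c.1

theorem next_inArc (D : LinkDiagram S R) (s : S) : D.next (D.inArc s) = s :=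
  D.next.apply_symm_apply s

theorem inArc_next (D : LinkDiagram S R) (s : S) : D.inArc (D.next s) = s :=
  D.next.symm_apply_apply s

theorem exists_crossing {s : S} (hs : D.mate s ≠ s) :
    ∃ c : D.Crossing, (s = c.o ∧ D.mate s = c.u) ∨ (s = c.u ∧ D.mate s = c.o) := by
  cases h : D.isOver s with
  | true => exact ⟨⟨s, hs, h⟩, Or.inl ⟨rfl, rfl⟩⟩
  | false =>
    refine ⟨⟨D.mate s, ?_, ?_⟩, Or.inr ⟨(D.mate_mate s).symm, rfl⟩⟩
    · rw [D.mate_mate]; exact hs.symm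
    · rw [D.isOver_mate s hs, h]; rfl

theorem Joined.point (m : D.Crossing → ℤˣ) {s : S} (hs : D.mate s = s) :
    D.Joined m (D.inArc s) s := Or.inl ⟨s, hs, rfl, rfl⟩

/-- A predicate on passages that is constant on the connected components of the projection. -/
structure Invariant (D : LinkDiagram S R) (P : S → Prop) : Prop where
  next : ∀ s, P (D.next s) ↔ P s
  mate : ∀ s, P (D.mate s) ↔ P s

theorem Invariant.inArc {P : S → Prop} (hP : D.Invariant P) (s : S) : P (D.inArc s) ↔ P s := by
  rw [← hP.next, D.next_inArc]

theorem Invariant.not {P : S → Prop} (hP : D.Invariant P) : D.Invariant fun s => ¬ P s :=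
  ⟨fun s => not_congr (hP.next s), fun s => not_congr (hP.mate s)⟩

theorem Invariant.joined {P : S → Prop} (hP : D.Invariant P) {m : D.Crossing → ℤˣ} {a b : S}
    (h : D.Joined m a b) : P a ↔ P b := by
  have key : ∀ c : D.Crossing, P c.u ↔ P c.o := fun c => hP.mate c.o
  rcases h with ⟨s, _, rfl, rfl⟩ | ⟨c, _, ⟨rfl, rfl⟩ | ⟨rfl, rfl⟩⟩ |
    ⟨c, _, ⟨rfl, rfl⟩ | ⟨rfl, rfl⟩⟩ <;>
    simp [hP.inArc, key]

/-- How a state joins the four arcs at a crossing. -/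
theorem joined_at_crossing {m : D.Crossing → ℤˣ} {K : Type*} (f : S → K)
    (hf : ∀ a b, D.Joined m a b → f a = f b) (c : D.Crossing) :
    (m c = c.sgn → f (D.inArc c.o) = f c.u ∧ f (D.inArc c.u) = f c.o) ∧
    (m c ≠ c.sgn → f (D.inArc c.o) = f (D.inArc c.u) ∧ f c.o = f c.u) :=
  ⟨fun h => ⟨hf _ _ (Or.inr (Or.inl ⟨c, h, Or.inl ⟨rfl, rfl⟩⟩)),
      hf _ _ (Or.inr (Or.inl ⟨c, h, Or.inr ⟨rfl, rfl⟩⟩))⟩,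
    fun h => ⟨hf _ _ (Or.inr (Or.inr ⟨c, h, Or.inl ⟨rfl, rfl⟩⟩)),
      hf _ _ (Or.inr (Or.inr ⟨c, h, Or.inr ⟨rfl, rfl⟩⟩))⟩⟩

/-- The values at the four arcs of a vertex of a function that is constant on state circles. -/
theorem balanced_of_joined {m : D.Crossing → ℤˣ} (f : S → ZMod 2)
    (hf : ∀ a b, D.Joined m a b → f a = f b) (s : S) :
    f (D.inArc s) + f s + (f (D.inArc (D.mate s)) + f (D.mate s)) = 0 := by
  by_cases hs : D.mate s = s
  · rw [hs, CharTwo.add_self_eq_zero]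
  · obtain ⟨c, hc⟩ := exists_crossing hs
    have h := joined_at_crossing f hf c
    have h0 : ∀ x y : ZMod 2, x + y + (x + y) = 0 := by decide
    have h1 : ∀ x y : ZMod 2, x + y + (y + x) = 0 := by decide
    by_cases hm : m c = c.sgn
    · obtain ⟨e1, e2⟩ := h.1 hm
      rcases hc with ⟨h3, h4⟩ | ⟨h3, h4⟩ <;> rw [h4, h3, e1, e2] <;> exact h1 _ _
    · obtain ⟨e1, e2⟩ := h.2 hm
      rcases hc with ⟨h3, h4⟩ | ⟨h3, h4⟩ <;> rw [h4, h3, e1, e2] <;> exact h0 _ _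

/-- A function that is constant on the circles of two opposite states is constant on the arcs at
each vertex. -/
theorem constant_of_joined {m m' : D.Crossing → ℤˣ} {K : Type*} (f : S → K)
    (hf : ∀ a b, D.Joined m a b → f a = f b) (hf' : ∀ a b, D.Joined m' a b → f a = f b)
    (s : S) (hmm' : ∀ c : D.Crossing, s = c.o ∨ s = c.u → m c ≠ m' c) :
    f (D.inArc s) = f s ∧ f (D.mate s) = f s := by
  by_cases hs : D.mate s = s
  · exact ⟨hf _ _ (Joined.point m hs), by rw [hs]⟩
  · obtain ⟨c, hc⟩ := exists_crossing hs
    have hne := hmm' c (by tauto)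
    have h := joined_at_crossing f hf c
    have h' := joined_at_crossing f hf' c
    by_cases hm : m c = c.sgn
    · have := h.1 hm
      have := h'.2 (fun e => hne (hm.trans e.symm))
      grind
    · have hm' : m' c = c.sgn := Int.units_eq_of_ne_of_ne hne hm
      have := h.2 hm
      have := h'.1 hm'
      grind

instance [Finite S] : Finite D.Crossing :=
  Subtype.finite (p := fun s => D.mate s ≠ s ∧ D.isOver s = true)

theorem card_crossing_subtype (P : S → Prop) :
    Nat.card {s : {s // P s} // D.mate s ≠ s ∧ D.isOver s = true} =
      Nat.card {c : D.Crossing // P c.o} :=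
  Nat.card_congr
    { toFun := fun s => ⟨⟨s.1.1, s.2⟩, s.1.2⟩
      invFun := fun c => ⟨⟨c.1.1, c.2⟩, c.1.2⟩
      left_inv := fun _ => rfl
      right_inv := fun _ => rfl }

open Classical in
/-- The genus inequality for a union of connected components of the projection and a pair of
opposite states. -/
theorem Invariant.card_circles_le [Finite S] {P : S → Prop} (hP : D.Invariant P)
    (m m' : D.Crossing → ℤˣ) (hmm' : ∀ c, m c ≠ m' c) :
    Nat.card (Quot fun a b : {s // P s} => D.Joined m a b) +
      Nat.card (Quot fun a b : {s // P s} => D.Joined m' a b) ≤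
    Nat.card {c : D.Crossing // P c.o} +
      2 * Nat.card (Quot fun a b : {s // P s} => componentRel D.next D.mate a b) := by
  let ν : Equiv.Perm {s // P s} := D.next.subtypePerm hP.next
  let τ : {s // P s} → {s // P s} := fun s => ⟨D.mate s, (hP.mate s).2 s.2⟩
  have hν : ∀ s, (ν.symm s).1 = D.inArc s.1 := by
    intro s
    rw [LinkDiagram.inArc, Equiv.eq_symm_apply]
    exact congrArg Subtype.val (ν.apply_symm_apply s)
  have hrel : componentRel ν τ = fun a b : {s // P s} => componentRel D.next D.mate a b := by
    funext a b
    simp only [componentRel, Subtype.ext_iff]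
    rfl
  -- Extension by zero respects state circles because no circle leaves `P`; the local statements at
  -- a vertex then apply to the whole diagram.
  let ext : ({s // P s} → ZMod 2) → S → ZMod 2 := fun f s => if h : P s then f ⟨s, h⟩ else 0
  have hext : ∀ f (s : {s // P s}), ext f s.1 = f s := fun f s => by simp [ext, s.2]
  have hcomp : ∀ (m : D.Crossing → ℤˣ) f,
      f ∈ compatible (ZMod 2) (fun a b : {s // P s} => D.Joined m a b) →
      ∀ a b, D.Joined m a b → ext f a = ext f b := by
    intro m f hf a b h
    by_cases ha : P a
    · have hb := (hP.joined h).1 ha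
      simp only [ext, ha, hb, dif_pos]
      exact hf ⟨a, ha⟩ ⟨b, hb⟩ h
    · have hb : ¬ P b := fun hb => ha ((hP.joined h).2 hb)
      simp only [ext, ha, hb, dif_neg, not_false_eq_true]
  have hbal : ∀ (m : D.Crossing → ℤˣ) f,
      f ∈ compatible (ZMod 2) (fun a b : {s // P s} => D.Joined m a b) →
      ∀ s, (τ s = s → f (ν.symm s) = f s) ∧
        f (ν.symm s) + f s + (f (ν.symm (τ s)) + f (τ s)) = 0 := by
    intro m f hf s
    constructor
    · intro hs
      refine hf _ _ ?_
      change D.Joined m (ν.symm s).1 s.1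
      rw [hν]
      exact Joined.point m (congrArg Subtype.val hs)
    · have := balanced_of_joined (ext f) (hcomp m f hf) s.1
      simp only [← hext, hν]
      exact this
  have h := card_quot_add_card_quot_le ν τ (fun s => Subtype.ext (D.mate_mate s))
    (fun s => D.isOver s = true)
    (fun s hs => by
      have : D.mate s ≠ s := fun h => hs (Subtype.ext h)
      change D.isOver (D.mate s) = true ↔ _
      rw [D.isOver_mate s this]; simp)
    (fun a b => D.Joined m a b) (fun a b => D.Joined m' a b) (hbal m) (hbal m') (by
      rintro f ⟨hf, hf'⟩ a b hab
      have key := fun s => constant_of_joined (ext f) (hcomp m f hf) (hcomp m' f hf') s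
        fun c _ => hmm' c
      rcases hab with rfl | rfl
      · have := (key (ν a).1).1
        rw [← hν, hext, hext] at this
        simpa using this
      · have := (key a.1).2
        rw [hext] at this
        rw [← this]
        exact hext f (τ a))
  rw [hrel] at h
  refine h.trans (le_of_eq ?_)
  congr 1
  rw [← card_crossing_subtype]
  refine Nat.card_congr (Equiv.subtypeEquivRight fun s => ?_)
  simp [τ, Subtype.ext_iff]

end LinkDiagram

namespace LinkDiagram

variable {S R : Type*} {D : LinkDiagram S R}

/-! ### Labellings and checkerboard colorings -/

/-- The requirements of `IsPlanar` except Euler's formula. -/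
structure IsLabelling (D : LinkDiagram S R) : Prop where
  point_left : ∀ s, D.mate s = s → D.left (D.inArc s) = D.left s
  point_right : ∀ s, D.mate s = s → D.right (D.inArc s) = D.right s
  corner_north : ∀ c : D.Crossing, D.right c.fall = c.north
  corner_south : ∀ c : D.Crossing, D.left (D.inArc c.fall) = c.south
  corner_west : ∀ c : D.Crossing, D.left (D.inArc c.rise) = c.west
  corner_east : ∀ c : D.Crossing, D.right (D.inArc c.fall) = c.east
  surj : ∀ X : R, ∃ s, D.left s = X ∨ D.right s = X
  sphere_connected : ∀ s t : S, Relation.EqvGen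
    (fun a b => b = D.next a ∨ b = D.mate a ∨ D.left a = D.left b ∨ D.left a = D.right b ∨
      D.right a = D.right b) s t

theorem IsPlanar.isLabelling (h : D.IsPlanar) : D.IsLabelling :=
  ⟨h.point_left, h.point_right, h.corner_north, h.corner_south, h.corner_west, h.corner_east,
    h.surj, h.sphere_connected⟩

theorem IsCheckerboard.right {χ : R → Bool} (hχ : D.IsCheckerboard χ) (s : S) :
    χ (D.right s) = !χ (D.left s) := by
  have := hχ s
  revert this
  cases χ (D.left s) <;> cases χ (D.right s) <;> simp

theorem IsCheckerboard.not {χ : R → Bool} (hχ : D.IsCheckerboard χ) :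
    D.IsCheckerboard fun X => !χ X := fun s h => hχ s (by simpa using h)

theorem Crossing.rise_fall (c : D.Crossing) :
    (c.sgn = 1 ∧ c.rise = c.o ∧ c.fall = c.u) ∨ (c.sgn = -1 ∧ c.rise = c.u ∧ c.fall = c.o) := by
  rcases Int.units_eq_one_or c.sgn with h | h
  · left; simp [Crossing.rise, Crossing.fall, h]
  · right; simp [Crossing.rise, Crossing.fall, h]

/-- The incidence number as a marker: the state `etaU χ` joins the black regions. -/
def Crossing.etaU (χ : R → Bool) (c : D.Crossing) : ℤˣ :=
  if χ c.north = true then c.sgn else - c.sgn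

theorem Crossing.etaU_not (χ : R → Bool) (c : D.Crossing) :
    c.etaU (fun X => !χ X) = - c.etaU χ := by
  cases h : χ c.north <;> simp [Crossing.etaU, h]

theorem Crossing.etaU_ne (χ : R → Bool) (c : D.Crossing) :
    c.etaU χ ≠ c.etaU (fun X => !χ X) := by
  rw [c.etaU_not]
  exact units_ne_neg_self _

theorem Crossing.etaU_eq_sgn_iff (χ : R → Bool) (c : D.Crossing) :
    c.etaU χ = c.sgn ↔ χ c.north = true := by
  cases h : χ c.north
  · simp [Crossing.etaU, h]
  · simp [Crossing.etaU, h]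

theorem Crossing.color_east {χ : R → Bool} (hχ : D.IsCheckerboard χ) (c : D.Crossing) :
    χ c.east = !χ c.north := by
  rw [Crossing.east, hχ.right]
  rfl

section coloring

variable (hL : D.IsLabelling) {χ : R → Bool} (hχ : D.IsCheckerboard χ)
include hL hχ

theorem Crossing.color_west (c : D.Crossing) : χ c.west = !χ c.north := by
  rw [← hL.corner_north, hχ.right, Bool.not_not]
  rfl

theorem Crossing.color_south (c : D.Crossing) : χ c.south = χ c.north := by
  rw [Crossing.south, hχ.right, hL.corner_west, c.color_west hL hχ, Bool.not_not]

theorem Crossing.coe_etaU (c : D.Crossing) : (c.etaU χ : ℤ) = c.eta χ := by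
  have h := c.color_west hL hχ
  rcases c.rise_fall with ⟨h1, _⟩ | ⟨h1, _⟩ <;> cases h2 : χ c.north <;>
    simp_all [Crossing.etaU, Crossing.eta, Crossing.swept]

/-- Passing through a crossing, a strand crosses the other strand, which separates the two regions
on its left. -/
theorem color_left_inArc {s : S} (hs : D.mate s ≠ s) :
    χ (D.left (D.inArc s)) = !χ (D.left s) := by
  obtain ⟨c, hc⟩ := exists_crossing hs
  have h1 : χ (D.left (D.inArc c.rise)) = !χ (D.left c.rise) := by
    rw [hL.corner_west, c.color_west hL hχ]; rfl
  have h2 : χ (D.left (D.inArc c.fall)) = !χ (D.left c.fall) := by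
    rw [hL.corner_south, c.color_south hL hχ]
    change _ = !χ c.west
    rw [c.color_west hL hχ, Bool.not_not]
  rcases hc with ⟨rfl, _⟩ | ⟨rfl, _⟩ <;>
    rcases c.rise_fall with ⟨_, h3, h4⟩ | ⟨_, h3, h4⟩ <;> simp_all

theorem Crossing.color_left_o (c : D.Crossing) :
    χ (D.left c.o) = true ↔ c.etaU χ = 1 := by
  have h := c.color_west hL hχ
  rcases c.rise_fall with ⟨h1, h2, h3⟩ | ⟨h1, h2, h3⟩
  · rw [← h2]
    change χ c.north = true ↔ _
    cases h2 : χ c.north <;> simp [Crossing.etaU, h1, h2]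
  · rw [← h3]
    change χ c.west = true ↔ _
    cases h2 : χ c.north <;> simp [Crossing.etaU, h1, h2, h]

theorem Crossing.color_left_u (c : D.Crossing) :
    χ (D.left c.u) = !χ (D.left c.o) := by
  have h := c.color_west hL hχ
  rcases c.rise_fall with ⟨h1, h2, h3⟩ | ⟨h1, h2, h3⟩
  · rw [← h2, ← h3]
    exact h
  · rw [← h2, ← h3]
    change χ c.north = !χ c.west
    rw [h, Bool.not_not]

end coloring

/-! ### White sides of arcs -/

theorem White.val_inj {χ : R → Bool} {X Y : White χ} : X.1 = Y.1 ↔ X = Y :=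
  ⟨Subtype.ext, congrArg Subtype.val⟩

/-- The white region next to an arc. -/
def IsCheckerboard.whiteSide {χ : R → Bool} (hχ : D.IsCheckerboard χ) (s : S) : White χ :=
  ⟨if χ (D.left s) = false then D.left s else D.right s, by
    split_ifs with h
    · exact h
    · rw [hχ.right]; simpa using h⟩

section whiteSide

variable {χ : R → Bool} (hχ : D.IsCheckerboard χ)

theorem IsCheckerboard.whiteSide_of_left {s : S} {X : White χ} (h : D.left s = X.1) :
    hχ.whiteSide s = X := by
  have : χ (D.left s) = false := by rw [h]; exact X.2
  apply Subtype.ext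
  exact (if_pos this).trans h

theorem IsCheckerboard.whiteSide_of_right {s : S} {X : White χ} (h : D.right s = X.1) :
    hχ.whiteSide s = X := by
  have h1 : χ (D.right s) = false := by rw [h]; exact X.2
  have h2 : ¬ χ (D.left s) = false := by
    intro h2
    rw [hχ.right, h2] at h1
    simp at h1
  apply Subtype.ext
  exact (if_neg h2).trans h

variable (hL : D.IsLabelling)
include hL

theorem IsCheckerboard.whiteSide_point {s : S} (hs : D.mate s = s) :
    hχ.whiteSide (D.inArc s) = hχ.whiteSide s := by
  cases h : χ (D.left s)
  · rw [hχ.whiteSide_of_left (s := s) (X := ⟨_, h⟩) rfl]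
    exact hχ.whiteSide_of_left (hL.point_left s hs)
  · have h' : χ (D.right s) = false := by rw [hχ.right, h]; rfl
    rw [hχ.whiteSide_of_right (s := s) (X := ⟨_, h'⟩) rfl]
    exact hχ.whiteSide_of_right (hL.point_right s hs)

/-- The white corners of a crossing at which north is black. -/
theorem Crossing.whiteSide_of_north_black (c : D.Crossing) (h : χ c.north = true) :
    ∃ E W : White χ, E.1 = c.east ∧ W.1 = c.west ∧ hχ.whiteSide c.rise = E ∧
      hχ.whiteSide (D.inArc c.fall) = E ∧ hχ.whiteSide c.fall = W ∧
      hχ.whiteSide (D.inArc c.rise) = W :=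
  ⟨⟨c.east, by rw [c.color_east hχ, h]; rfl⟩, ⟨c.west, by rw [c.color_west hL hχ, h]; rfl⟩,
    rfl, rfl, hχ.whiteSide_of_right rfl, hχ.whiteSide_of_right (hL.corner_east c),
    hχ.whiteSide_of_left rfl, hχ.whiteSide_of_left (hL.corner_west c)⟩

/-- The white corners of a crossing at which north is white. -/
theorem Crossing.whiteSide_of_north_white (c : D.Crossing) (h : χ c.north = false) :
    ∃ N T : White χ, N.1 = c.north ∧ T.1 = c.south ∧ hχ.whiteSide c.rise = N ∧
      hχ.whiteSide c.fall = N ∧ hχ.whiteSide (D.inArc c.rise) = T ∧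
      hχ.whiteSide (D.inArc c.fall) = T :=
  ⟨⟨c.north, h⟩, ⟨c.south, by rw [c.color_south hL hχ, h]⟩,
    rfl, rfl, hχ.whiteSide_of_left rfl, hχ.whiteSide_of_right (hL.corner_north c),
    hχ.whiteSide_of_right rfl, hχ.whiteSide_of_left (hL.corner_south c)⟩

theorem Crossing.whiteSide_eq_of_north_black (c : D.Crossing) (h : χ c.north = true) :
    hχ.whiteSide (D.inArc c.o) = hχ.whiteSide c.u ∧
      hχ.whiteSide (D.inArc c.u) = hχ.whiteSide c.o := by
  obtain ⟨E, W, -, -, h1, h2, h3, h4⟩ := c.whiteSide_of_north_black hχ hL h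
  rcases c.rise_fall with ⟨_, h5, h6⟩ | ⟨_, h5, h6⟩ <;> simp_all

theorem Crossing.whiteSide_eq_of_north_white (c : D.Crossing) (h : χ c.north = false) :
    hχ.whiteSide (D.inArc c.o) = hχ.whiteSide (D.inArc c.u) ∧
      hχ.whiteSide c.o = hχ.whiteSide c.u := by
  obtain ⟨E, W, -, -, h1, h2, h3, h4⟩ := c.whiteSide_of_north_white hχ hL h
  rcases c.rise_fall with ⟨_, h5, h6⟩ | ⟨_, h5, h6⟩ <;> simp_all

/-- The arcs before and after the over-passage border opposite white corners, whichever pair of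
corners is white. This removes the case distinction from the Goeritz matrix. -/
theorem Crossing.connects_iff (c : D.Crossing) (X Y : White χ) :
    c.Connects χ X Y ↔ (X = hχ.whiteSide c.o ∧ Y = hχ.whiteSide (D.inArc c.o)) ∨
      (Y = hχ.whiteSide c.o ∧ X = hχ.whiteSide (D.inArc c.o)) := by
  cases h : χ c.north
  · obtain ⟨E, W, e, e', h1, h2, h3, h4⟩ := c.whiteSide_of_north_white hχ hL h
    rw [Crossing.Connects, if_neg (by simp [h]), ← e, ← e']
    rcases c.rise_fall with ⟨_, h5, h6⟩ | ⟨_, h5, h6⟩ <;>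
      · rw [h5] at h1 h3
        rw [h6] at h2 h4
        simp only [h1, h2, h3, h4, White.val_inj]
        tauto
  · obtain ⟨E, W, e, e', h1, h2, h3, h4⟩ := c.whiteSide_of_north_black hχ hL h
    rw [Crossing.Connects, if_pos h, ← e, ← e']
    rcases c.rise_fall with ⟨_, h5, h6⟩ | ⟨_, h5, h6⟩ <;>
      · rw [h5] at h1 h4
        rw [h6] at h2 h3
        simp only [h1, h2, h3, h4, White.val_inj]
        tauto

/-- The state joins the black regions and cuts the white ones apart, so each of its circles runs
along a single white region. -/
theorem IsCheckerboard.whiteSide_joined {a b : S} (h : D.Joined (Crossing.etaU χ) a b) :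
    hχ.whiteSide a = hχ.whiteSide b := by
  rcases h with ⟨s, hs, rfl, rfl⟩ | ⟨c, hc, h⟩ | ⟨c, hc, h⟩
  · exact hχ.whiteSide_point hL hs
  · have := c.whiteSide_eq_of_north_black hχ hL ((c.etaU_eq_sgn_iff χ).1 hc)
    rcases h with ⟨rfl, rfl⟩ | ⟨rfl, rfl⟩
    exacts [this.1, this.2]
  · rw [Ne, c.etaU_eq_sgn_iff χ, Bool.not_eq_true] at hc
    have := c.whiteSide_eq_of_north_white hχ hL hc
    rcases h with ⟨rfl, rfl⟩ | ⟨rfl, rfl⟩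
    exacts [this.1, this.2]

theorem IsCheckerboard.whiteSide_surjective : Function.Surjective hχ.whiteSide := by
  intro X
  obtain ⟨s, hs | hs⟩ := hL.surj X.1
  · exact ⟨s, hχ.whiteSide_of_left hs⟩
  · exact ⟨s, hχ.whiteSide_of_right hs⟩

end whiteSide

end LinkDiagram

theorem finrank_fun_eq_natCard (ι : Type*) [Finite ι] : finrank ℝ (ι → ℝ) = Nat.card ι := by
  have := Fintype.ofFinite ι
  rw [finrank_fintype_fun_eq_card, Nat.card_eq_fintype_card]

namespace LinkDiagram

variable {S R : Type*} {D : LinkDiagram S R}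

instance [Finite S] (m : D.Crossing → ℤˣ) : Finite (D.StateCircle m) :=
  inferInstanceAs (Finite (Quot _))

instance [Finite S] : Finite D.Component := inferInstanceAs (Finite (Quot _))

/-! ### Counting passages, and Euler's formula -/

theorem card_passages [Finite S] (D : LinkDiagram S R) :
    Nat.card S = Nat.card D.Point + 2 * Nat.card D.Crossing := by
  have hfin : Finite D.Point := Subtype.finite (p := fun s => D.mate s = s)
  have hbij : Function.Bijective (Sum.elim (fun s : D.Point => s.1)
      (Sum.elim (fun c : D.Crossing => c.o) fun c : D.Crossing => c.u)) := by
    have hu : ∀ c : D.Crossing, D.mate c.u ≠ c.u := fun c h => c.2.1 (by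
      rw [c.mate_u] at h; exact h.symm)
    have ho : ∀ c : D.Crossing, D.mate c.o ≠ c.o := fun c => c.2.1
    have hou : ∀ c c' : D.Crossing, c.o ≠ c'.u := fun c c' h => by
      have h1 : D.isOver c.o = true := c.2.2
      have h2 : D.isOver c'.u = !D.isOver c'.o := D.isOver_mate _ (ho c')
      have h3 : D.isOver c'.o = true := c'.2.2
      rw [h, h2, h3] at h1
      simp at h1
    constructor
    · rintro (s | c | c) (t | c' | c') h
      · exact congrArg _ (Subtype.ext h)
      · exact absurd s.2 (by rw [show s.1 = c'.o from h]; exact ho c')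
      · exact absurd s.2 (by rw [show s.1 = c'.u from h]; exact hu c')
      · exact absurd t.2 (by rw [show t.1 = c.o from h.symm]; exact ho c)
      · exact congrArg (fun x => Sum.inr (Sum.inl x)) (Subtype.ext h)
      · exact absurd h (hou c c')
      · exact absurd t.2 (by rw [show t.1 = c.u from h.symm]; exact hu c)
      · exact absurd h.symm (hou c' c)
      · refine congrArg (fun x => Sum.inr (Sum.inr x)) (Subtype.ext ?_)
        change c.o = c'.o
        rw [← c.mate_u, ← c'.mate_u]
        exact congrArg D.mate h
    · intro s
      by_cases hs : D.mate s = s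
      · exact ⟨Sum.inl ⟨s, hs⟩, rfl⟩
      · obtain ⟨c, ⟨rfl, _⟩ | ⟨rfl, _⟩⟩ := exists_crossing hs
        · exact ⟨Sum.inr (Sum.inl c), rfl⟩
        · exact ⟨Sum.inr (Sum.inr c), rfl⟩
  rw [← Nat.card_congr (Equiv.ofBijective _ hbij), Nat.card_sum, Nat.card_sum]
  ring

/-- Euler's formula for a diagram, in terms of crossings and components. -/
theorem euler_iff [Finite S] (D : LinkDiagram S R) :
    (((Nat.card D.Crossing + Nat.card D.Point : ℕ) : ℤ) - Nat.card S + Nat.card R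
      = 1 + Nat.card D.Component) ↔
    Nat.card R = 1 + Nat.card D.Component + Nat.card D.Crossing := by
  have := D.card_passages
  omega

/-! ### State circles, regions and components -/

theorem component_inArc (s : S) :
    (Quot.mk _ (D.inArc s) : D.Component) = Quot.mk _ s :=
  Quot.sound (Or.inl (D.next_inArc s).symm)

theorem component_u (c : D.Crossing) : (Quot.mk _ c.o : D.Component) = Quot.mk _ c.u :=
  Quot.sound (Or.inr rfl)

theorem component_joined {m : D.Crossing → ℤˣ} {a b : S} (h : D.Joined m a b) :
    (Quot.mk _ a : D.Component) = Quot.mk _ b := by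
  rcases h with ⟨s, _, rfl, rfl⟩ | ⟨c, _, ⟨rfl, rfl⟩ | ⟨rfl, rfl⟩⟩ | ⟨c, _, ⟨rfl, rfl⟩ | ⟨rfl, rfl⟩⟩
  · exact component_inArc _
  · exact (component_inArc _).trans (component_u c)
  · exact (component_inArc _).trans (component_u c).symm
  · exact (component_inArc _).trans ((component_u c).trans (component_inArc _).symm)
  · exact component_u c

/-- The connected component of the projection that contains a state circle. -/
def circleComponent (m : D.Crossing → ℤˣ) : D.StateCircle m → D.Component :=
  Quot.lift (Quot.mk _) fun _ _ h => component_joined h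

section incidence

variable (hL : D.IsLabelling) {χ : R → Bool} (hχ : D.IsCheckerboard χ)

/-- The white region bounded by a circle of the state that joins the black regions. -/
def IsLabelling.circleRegion : D.StateCircle (Crossing.etaU χ) → White χ :=
  Quot.lift hχ.whiteSide fun _ _ h => hχ.whiteSide_joined hL h

/-- The coboundary map of the graph that has the white regions and the connected components of the
projection as vertices and the boundary circles of the white regions as edges. -/
def IsLabelling.incidence : (White χ → ℝ) × (D.Component → ℝ) →ₗ[ℝ]
    (D.StateCircle (Crossing.etaU χ) → ℝ) :=
  LinearMap.funLeft ℝ ℝ (hL.circleRegion hχ) ∘ₗ LinearMap.fst ℝ _ _ -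
    LinearMap.funLeft ℝ ℝ (circleComponent _) ∘ₗ LinearMap.snd ℝ _ _

/-- The coboundary map of the graph that has all regions and the connected components of the
projection as vertices. -/
def IsLabelling.fullIncidence : (R → ℝ) × (D.Component → ℝ) →ₗ[ℝ]
    (D.StateCircle (Crossing.etaU χ) → ℝ) × (D.StateCircle (Crossing.etaU fun X => !χ X) → ℝ) :=
  (hL.incidence hχ ∘ₗ (LinearMap.funLeft ℝ ℝ Subtype.val).prodMap LinearMap.id).prod
    (hL.incidence hχ.not ∘ₗ (LinearMap.funLeft ℝ ℝ Subtype.val).prodMap LinearMap.id)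

theorem IsCheckerboard.sides (s : S) :
    (D.left s = (hχ.whiteSide s).1 ∧ D.right s = (hχ.not.whiteSide s).1) ∨
      (D.right s = (hχ.whiteSide s).1 ∧ D.left s = (hχ.not.whiteSide s).1) := by
  cases h : χ (D.left s)
  · left
    have h' : (!χ (D.right s)) = false := by rw [hχ.right, h]; rfl
    rw [hχ.whiteSide_of_left (X := ⟨_, h⟩) rfl, hχ.not.whiteSide_of_right (X := ⟨_, h'⟩) rfl]
    exact ⟨rfl, rfl⟩
  · right
    have h' : χ (D.right s) = false := by rw [hχ.right, h]; rfl
    have h'' : (!χ (D.left s)) = false := by rw [h]; rfl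
    rw [hχ.whiteSide_of_right (X := ⟨_, h'⟩) rfl, hχ.not.whiteSide_of_left (X := ⟨_, h''⟩) rfl]
    exact ⟨rfl, rfl⟩

/-- In the kernel, the value at a region equals the value at every component that it touches, so
connectedness of the sphere leaves only the constants. -/
theorem IsLabelling.ker_fullIncidence_le :
    finrank ℝ (LinearMap.ker (hL.fullIncidence hχ)) ≤ 1 := by
  rcases isEmpty_or_nonempty S with hS | ⟨⟨s₀⟩⟩
  · have : Subsingleton ((R → ℝ) × (D.Component → ℝ)) := by
      have h1 : IsEmpty R := ⟨fun X => hS.elim (hL.surj X).choose⟩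
      have h2 : IsEmpty D.Component := ⟨fun q => hS.elim (Quot.exists_rep q).choose⟩
      infer_instance
    rw [finrank_zero_of_subsingleton]
    exact zero_le_one
  refine le_trans (Submodule.finrank_mono (t := Submodule.span ℝ {((fun _ => 1), (fun _ => 1))})
    ?_) ((finrank_span_le_card _).trans (by simp))
  rintro ⟨x, y⟩ h
  have h := LinearMap.mem_ker.1 h
  have hw : ∀ s, x (hχ.whiteSide s).1 = y (Quot.mk _ s) := fun s =>
    sub_eq_zero.1 (congrFun (congrArg Prod.fst h) (Quot.mk _ s))
  have hb : ∀ s, x (hχ.not.whiteSide s).1 = y (Quot.mk _ s) := fun s =>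
    sub_eq_zero.1 (congrFun (congrArg Prod.snd h) (Quot.mk _ s))
  have hl : ∀ s, x (D.left s) = y (Quot.mk _ s) := fun s => by
    rcases hχ.sides s with ⟨h1, h2⟩ | ⟨h1, h2⟩
    · rw [h1, hw]
    · rw [h2, hb]
  have hr : ∀ s, x (D.right s) = y (Quot.mk _ s) := fun s => by
    rcases hχ.sides s with ⟨h1, h2⟩ | ⟨h1, h2⟩
    · rw [h2, hb]
    · rw [h1, hw]
  have hy : ∀ s, y (Quot.mk _ s) = y (Quot.mk _ s₀) := by
    intro s
    induction hL.sphere_connected s s₀ with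
    | rel a b h =>
      rcases h with h | h | h | h | h
      · exact congrArg y (Quot.sound (Or.inl h))
      · exact congrArg y (Quot.sound (Or.inr h))
      · rw [← hl, h, hl]
      · rw [← hl, h, hr]
      · rw [← hr, h, hr]
    | refl a => rfl
    | symm a b _ ih => exact ih.symm
    | trans a b c _ _ ih ih' => exact ih.trans ih'
  refine Submodule.mem_span_singleton.2 ⟨y (Quot.mk _ s₀), ?_⟩
  refine Prod.ext (funext fun X => ?_) (funext fun q => ?_)
  · obtain ⟨s, rfl | rfl⟩ := hL.surj X
    · simp [hl, hy s]
    · simp [hr, hy s]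
  · obtain ⟨s, rfl⟩ := Quot.exists_rep q
    exact (mul_one _).trans (hy s).symm

variable [Finite S] [Finite R]
include hL hχ

theorem IsLabelling.finrank_range_fullIncidence :
    Nat.card R + Nat.card D.Component ≤
      finrank ℝ (LinearMap.range (hL.fullIncidence hχ)) + 1 := by
  have h1 := (hL.fullIncidence hχ).finrank_range_add_finrank_ker
  have h2 := hL.ker_fullIncidence_le hχ
  rw [finrank_prod, finrank_fun_eq_natCard, finrank_fun_eq_natCard] at h1
  omega

/-- A connected graph has at least one edge fewer than vertices; here the edges are the circles of
both checkerboard states. -/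
theorem IsLabelling.card_region_add_card_component_le :
    Nat.card R + Nat.card D.Component ≤ Nat.card (D.StateCircle (Crossing.etaU χ)) +
      Nat.card (D.StateCircle (Crossing.etaU fun X => !χ X)) + 1 := by
  have h1 := hL.finrank_range_fullIncidence hχ
  have h2 := Submodule.finrank_le (LinearMap.range (hL.fullIncidence hχ))
  rw [finrank_prod, finrank_fun_eq_natCard, finrank_fun_eq_natCard] at h2
  omega

/-- If the bound is attained, the connected graph is a tree and its coboundary map is onto; so is
the part that belongs to the circles along white regions. -/
theorem IsLabelling.incidence_surjective
    (h : Nat.card (D.StateCircle (Crossing.etaU χ)) +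
      Nat.card (D.StateCircle (Crossing.etaU fun X => !χ X)) + 1 ≤
      Nat.card R + Nat.card D.Component) :
    Function.Surjective (hL.incidence hχ) := by
  have h1 := hL.finrank_range_fullIncidence hχ
  have h3 : LinearMap.range (hL.fullIncidence hχ) = ⊤ := by
    apply Submodule.eq_top_of_finrank_eq
    apply le_antisymm (Submodule.finrank_le _)
    rw [finrank_prod, finrank_fun_eq_natCard, finrank_fun_eq_natCard]
    omega
  intro g
  obtain ⟨z, hz⟩ := LinearMap.range_eq_top.1 h3 (g, 0)
  exact ⟨_, congrArg Prod.fst hz⟩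

end incidence

end LinkDiagram

namespace LinkDiagram

variable {S R : Type*} {D : LinkDiagram S R}

/-! ### The graph of white regions and crossings -/

section edges

variable {χ : R → Bool} (hχ : D.IsCheckerboard χ)

/-- The coboundary map of the graph that has the white regions as vertices and the crossings as
edges. -/
def IsCheckerboard.edgeMap : (White χ → ℝ) →ₗ[ℝ] (D.Crossing → ℝ) :=
  LinearMap.funLeft ℝ ℝ (fun c => hχ.whiteSide c.o) -
    LinearMap.funLeft ℝ ℝ (fun c => hχ.whiteSide (D.inArc c.o))

theorem IsCheckerboard.edgeMap_apply (x : White χ → ℝ) (c : D.Crossing) :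
    hχ.edgeMap x c = x (hχ.whiteSide c.o) - x (hχ.whiteSide (D.inArc c.o)) := rfl

variable (hL : D.IsLabelling)
include hL

theorem IsLabelling.constant_of_mem_ker_edgeMap {x : White χ → ℝ} (hx : hχ.edgeMap x = 0) (s : S) :
    x (hχ.whiteSide (D.inArc s)) = x (hχ.whiteSide s) ∧
      x (hχ.whiteSide (D.mate s)) = x (hχ.whiteSide s) := by
  by_cases hs : D.mate s = s
  · rw [hχ.whiteSide_point hL hs, hs]
    exact ⟨rfl, rfl⟩
  · obtain ⟨c, hc⟩ := exists_crossing hs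
    have h0 := sub_eq_zero.1 (congrFun hx c)
    change x (hχ.whiteSide c.o) = x (hχ.whiteSide (D.inArc c.o)) at h0
    cases h : χ c.north
    · have h1 := c.whiteSide_eq_of_north_white hχ hL h
      grind
    · have h1 := c.whiteSide_eq_of_north_black hχ hL h
      grind

/-- A potential on the white regions without differences across crossings is constant around each
component of the projection, and these constants complete it to a kernel vector of the incidence
map. -/
theorem IsLabelling.finrank_ker_edgeMap_le [Finite S] [Finite R] :
    finrank ℝ (LinearMap.ker hχ.edgeMap) ≤ finrank ℝ (LinearMap.ker (hL.incidence hχ)) := by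
  have hy : ∀ x ∈ LinearMap.ker hχ.edgeMap, ∃ y : D.Component → ℝ,
      (x, y) ∈ LinearMap.ker (hL.incidence hχ) := by
    intro x hx
    have key := hL.constant_of_mem_ker_edgeMap hχ (LinearMap.mem_ker.1 hx)
    refine ⟨Quot.lift (fun s => x (hχ.whiteSide s)) ?_, ?_⟩
    · rintro a b (rfl | rfl)
      · have := (key (D.next a)).1
        rwa [D.inArc_next] at this
      · exact (key a).2.symm
    · rw [LinearMap.mem_ker]
      funext q
      obtain ⟨s, rfl⟩ := Quot.exists_rep q
      exact sub_self _
  have hle : LinearMap.ker hχ.edgeMap ≤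
      (LinearMap.ker (hL.incidence hχ)).map (LinearMap.fst ℝ _ _) := by
    intro x hx
    obtain ⟨y, h⟩ := hy x hx
    exact ⟨(x, y), h, rfl⟩
  exact (Submodule.finrank_mono hle).trans (Submodule.finrank_map_le _ _)

/-- The lower bound for the total rank; surjectivity gives the dimension of the kernel of the
incidence map exactly. -/
theorem IsLabelling.le_finrank_range_edgeMap [Finite S] [Finite R]
    (hsurj : Function.Surjective (hL.incidence hχ)) :
    Nat.card (D.StateCircle (Crossing.etaU χ)) ≤
      finrank ℝ (LinearMap.range hχ.edgeMap) + Nat.card D.Component := by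
  have h1 := hχ.edgeMap.finrank_range_add_finrank_ker
  have h2 := (hL.incidence hχ).finrank_range_add_finrank_ker
  have h3 := hL.finrank_ker_edgeMap_le hχ
  rw [LinearMap.range_eq_top.2 hsurj, finrank_top, finrank_prod] at h2
  simp only [finrank_fun_eq_natCard] at h1 h2
  omega

/-- The differences over crossings in `P` factor through functions on the circles in `P`, as the
coboundary of the graph with these circles as vertices and crossings as edges. Functions constant on
components lie in its kernel. -/
theorem Invariant.finrank_range_edgeMap_le [Finite S] [Finite R] {P : S → Prop}
    (hP : D.Invariant P) :
    finrank ℝ (LinearMap.range (hχ.edgeMap.coordsOn fun c => P c.o)) +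
      Nat.card (Quot fun a b : {s // P s} => componentRel D.next D.mate a b) ≤
    Nat.card (Quot fun a b : {s // P s} => D.Joined (Crossing.etaU χ) a b) := by
  set J := fun a b : {s // P s} => D.Joined (Crossing.etaU χ) a b
  set C := fun a b : {s // P s} => componentRel D.next D.mate a b
  let A : (White χ → ℝ) →ₗ[ℝ] (Quot J → ℝ) :=
    LinearMap.funLeft ℝ ℝ (Quot.lift (fun s => hχ.whiteSide s.1)
      fun _ _ h => hχ.whiteSide_joined hL h)
  let B : (Quot J → ℝ) →ₗ[ℝ] ({c : D.Crossing // P c.o} → ℝ) :=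
    LinearMap.funLeft ℝ ℝ (fun c => Quot.mk J ⟨c.1.o, c.2⟩) -
      LinearMap.funLeft ℝ ℝ (fun c => Quot.mk J ⟨D.inArc c.1.o, (hP.inArc _).2 c.2⟩)
  have hBA : hχ.edgeMap.coordsOn (fun c => P c.o) = B ∘ₗ A := rfl
  have h1 := B.finrank_range_add_finrank_ker
  have h2 : finrank ℝ (LinearMap.range (B ∘ₗ A)) ≤ finrank ℝ (LinearMap.range B) :=
    Submodule.finrank_mono (LinearMap.range_comp_le_range A B)
  have hnext : ∀ s (h : P s), Quot.mk C ⟨D.inArc s, (hP.inArc _).2 h⟩ = Quot.mk C ⟨s, h⟩ :=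
    fun s h => Quot.sound (Or.inl (D.next_inArc s).symm)
  have hmate : ∀ s (h : P s), Quot.mk C ⟨s, h⟩ = Quot.mk C ⟨D.mate s, (hP.mate _).2 h⟩ :=
    fun s h => Quot.sound (Or.inr rfl)
  have hjc : ∀ a b, J a b → Quot.mk C a = Quot.mk C b := by
    rintro ⟨a, ha⟩ ⟨b, hb⟩ h
    have hu : ∀ (c : D.Crossing) (h : P c.o) (h' : P c.u),
      Quot.mk C ⟨c.o, h⟩ = Quot.mk C ⟨c.u, h'⟩ := fun c h _ => hmate c.o h
    have hi : ∀ s h (h' : P s), Quot.mk C ⟨D.inArc s, h⟩ = Quot.mk C ⟨s, h'⟩ :=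
      fun s _ h' => hnext s h'
    have hPi := hP.inArc
    have hPu : ∀ c : D.Crossing, P c.u ↔ P c.o := fun c => hP.mate c.o
    rcases h with ⟨s, _, h1, h2⟩ | ⟨c, _, ⟨h1, h2⟩ | ⟨h1, h2⟩⟩ | ⟨c, _, ⟨h1, h2⟩ | ⟨h1, h2⟩⟩ <;>
      simp only at h1 h2 <;> subst h1 <;> subst h2
    · exact hi _ _ _
    · rw [hi _ _ ((hPi _).1 ha), hu]
    · rw [hi _ _ ((hPi _).1 ha), hu]
    · rw [hi _ _ ((hPi _).1 ha), hi _ _ ((hPi _).1 hb), hu]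
    · exact hu _ _ _
  have h3 : Nat.card (Quot C) ≤ finrank ℝ (LinearMap.ker B) := by
    rw [← finrank_fun_eq_natCard]
    let φ : (Quot C → ℝ) →ₗ[ℝ] LinearMap.ker B :=
      LinearMap.codRestrict _ (LinearMap.funLeft ℝ ℝ (Quot.lift (Quot.mk C) hjc)) (by
        intro g
        rw [LinearMap.mem_ker]
        funext c
        exact sub_eq_zero.2 (congrArg g (hnext _ _).symm))
    refine LinearMap.finrank_le_finrank_of_injective (f := φ) fun g g' h => ?_
    funext q
    obtain ⟨s, rfl⟩ := Quot.exists_rep q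
    exact congrFun (congrArg Subtype.val h) (Quot.mk J s)
  rw [finrank_fun_eq_natCard] at h1
  rw [hBA]
  omega

end edges

/-! ### The Goeritz form -/

section goeritz

variable [Finite R] {χ : R → Bool} (hχ : D.IsCheckerboard χ) (hL : D.IsLabelling)
include hL

-- The pair of white corners occurs in both orders, and a(a - b) + b(b - a) = (a - b)². If both
-- corners are the same region, all terms vanish.
open Classical in
theorem IsLabelling.sum_connects (z : White χ → ℝ) (c : D.Crossing) :
    ∑ X, ∑ Y, (if c.Connects χ X Y then z X * (z X - z Y) else 0) = hχ.edgeMap z c ^ 2 := by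
  rw [hχ.edgeMap_apply]
  simp only [c.connects_iff hχ hL]
  generalize hχ.whiteSide c.o = a
  generalize hχ.whiteSide (D.inArc c.o) = b
  by_cases hab : a = b
  · subst hab
    rw [sub_self, zero_pow two_ne_zero]
    refine Finset.sum_eq_zero fun X _ => Finset.sum_eq_zero fun Y _ => ?_
    split_ifs with h
    · rcases h with ⟨rfl, rfl⟩ | ⟨rfl, rfl⟩ <;> simp
    · rfl
  · have h : ∀ X Y : White χ, (if X = a ∧ Y = b ∨ Y = a ∧ X = b then z X * (z X - z Y) else 0) =
        (if X = a then if Y = b then z X * (z X - z Y) else 0 else 0) +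
        (if X = b then if Y = a then z X * (z X - z Y) else 0 else 0) := by
      intro X Y
      by_cases h1 : X = a <;> by_cases h2 : X = b <;> by_cases h3 : Y = a <;>
        by_cases h4 : Y = b <;> simp_all
    simp only [h, Finset.sum_add_distrib]
    have h' : ∀ a b : White χ,
        ∑ X, ∑ Y, (if X = a then if Y = b then z X * (z X - z Y) else 0 else 0) =
          z a * (z a - z b) := by
      intro a b
      rw [Finset.sum_eq_single a (fun X _ h => by simp [h]) (by simp)]
      simp
    rw [h', h']
    ring

-- The rows of the unreduced matrix sum to zero, so the form is the sum of -g(X,Y) z(X)(z(X) -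
-- z(Y)), which regroups by crossings.
open Classical in
theorem IsLabelling.unreducedGoeritz_form [Finite S] (z : White χ → ℝ) :
    ∑ X, ∑ Y, z X * (D.unreducedGoeritz χ X Y : ℝ) * z Y =
      ∑ c : D.Crossing, (c.etaU χ : ℝ) * hχ.edgeMap z c ^ 2 := by
  have h1 : ∀ X, ∑ Y, z X * (D.unreducedGoeritz χ X Y : ℝ) * z Y =
      ∑ Y, - (D.goeritzEntry χ X Y : ℝ) * (z X * (z X - z Y)) := by
    intro X
    rw [← Finset.add_sum_erase _ _ (Finset.mem_univ X),
      ← Finset.add_sum_erase _ (fun Y => - (D.goeritzEntry χ X Y : ℝ) * _) (Finset.mem_univ X)]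
    simp only [unreducedGoeritz, if_true, sub_self, mul_zero, zero_add]
    push_cast
    rw [← Finset.sum_neg_distrib, Finset.mul_sum, Finset.sum_mul, ← Finset.sum_add_distrib]
    refine Finset.sum_congr rfl fun Y hY => ?_
    rw [if_neg (Finset.ne_of_mem_erase hY).symm]
    ring
  simp only [h1, goeritzEntry]
  push_cast
  simp only [neg_neg, Finset.sum_mul]
  have h2 : ∀ X Y : White χ, ∀ c : D.Crossing,
      ((if c.Connects χ X Y then (c.eta χ : ℝ) else 0)) * (z X * (z X - z Y)) =
        (c.etaU χ : ℝ) * (if c.Connects χ X Y then z X * (z X - z Y) else 0) := by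
    intro X Y c
    have : ((c.etaU χ : ℤ) : ℝ) = (c.eta χ : ℝ) := by rw [c.coe_etaU hL hχ]
    rw [← this]
    split_ifs <;> simp
  simp only [h2]
  have h3 : ∀ X : White χ, ∑ Y, ∑ c : D.Crossing,
      (c.etaU χ : ℝ) * (if c.Connects χ X Y then z X * (z X - z Y) else 0) =
      ∑ c : D.Crossing, ∑ Y,
        (c.etaU χ : ℝ) * (if c.Connects χ X Y then z X * (z X - z Y) else 0) :=
    fun X => Finset.sum_comm
  simp only [h3]
  rw [Finset.sum_comm]
  refine Finset.sum_congr rfl fun c _ => ?_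
  rw [← hL.sum_connects hχ z c]
  simp only [Finset.mul_sum]

end goeritz

end LinkDiagram

namespace LinkDiagram

variable {S R : Type*} {D : LinkDiagram S R}

/-! ### Counting on a union of components -/

/-- The number of circles of a state in the part of the diagram given by `P`. -/
noncomputable def numCirclesOn (D : LinkDiagram S R) (m : D.Crossing → ℤˣ) (P : S → Prop) : ℕ :=
  Nat.card (Quot fun a b : {s // P s} => D.Joined m a b)

/-- The number of connected components of the part of the projection given by `P`. -/
noncomputable def numComponentsOn (D : LinkDiagram S R) (P : S → Prop) : ℕ :=
  Nat.card (Quot fun a b : {s // P s} => componentRel D.next D.mate a b)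

/-- The number of crossings in the part of the diagram given by `P`. -/
noncomputable def numCrossingsOn (D : LinkDiagram S R) (P : S → Prop) : ℕ :=
  Nat.card {c : D.Crossing // P c.o}

theorem card_crossing [Finite S] (P : S → Prop) :
    Nat.card D.Crossing = D.numCrossingsOn P + D.numCrossingsOn fun s => ¬ P s := by
  classical
  rw [numCrossingsOn, numCrossingsOn, ← Nat.card_sum]
  exact (Nat.card_congr (Equiv.sumCompl _)).symm

section split

variable {P : S → Prop} (hP : D.Invariant P)
include hP

theorem Invariant.card_stateCircle [Finite S] (m : D.Crossing → ℤˣ) :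
    Nat.card (D.StateCircle m) = D.numCirclesOn m P + D.numCirclesOn m fun s => ¬ P s :=
  Nat.card_quot_split _ P fun _ _ h => hP.joined h

theorem Invariant.card_component [Finite S] :
    Nat.card D.Component = D.numComponentsOn P + D.numComponentsOn fun s => ¬ P s := by
  refine Nat.card_quot_split _ P ?_
  rintro a b (rfl | rfl)
  · exact (hP.next a).symm
  · exact (hP.mate a).symm

theorem Invariant.joined_congr {m m' : D.Crossing → ℤˣ} (hm : ∀ c, P c.o → m c = m' c)
    {a b : S} (ha : P a) (h : D.Joined m a b) : D.Joined m' a b := by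
  have hPu : ∀ c : D.Crossing, P c.u ↔ P c.o := fun c => hP.mate c.o
  rcases h with h | ⟨c, h1, h2⟩ | ⟨c, h1, h2⟩
  · exact Or.inl h
  all_goals
    have hc : P c.o := by
      rcases h2 with ⟨rfl, rfl⟩ | ⟨rfl, rfl⟩ <;> simpa [hP.inArc, hPu] using ha
    rw [hm c hc] at h1
  · exact Or.inr (Or.inl ⟨c, h1, h2⟩)
  · exact Or.inr (Or.inr ⟨c, h1, h2⟩)

theorem Invariant.numCirclesOn_congr {m m' : D.Crossing → ℤˣ} (hm : ∀ c, P c.o → m c = m' c) :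
    D.numCirclesOn m P = D.numCirclesOn m' P := by
  have : (fun a b : {s // P s} => D.Joined m a b) = fun a b : {s // P s} => D.Joined m' a b := by
    funext a b
    exact propext ⟨hP.joined_congr hm a.2, hP.joined_congr (fun c h => (hm c h).symm) a.2⟩
  rw [numCirclesOn, this, numCirclesOn]

end split

/-! ### Genus inequality against Euler's formula. -/

theorem Invariant.genus_le [Finite S] {P : S → Prop} (hP : D.Invariant P) (χ : R → Bool) :
    D.numCirclesOn (Crossing.etaU χ) P + D.numCirclesOn (Crossing.etaU fun X => !χ X) P ≤
      D.numCrossingsOn P + 2 * D.numComponentsOn P :=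
  hP.card_circles_le _ _ fun c => c.etaU_ne χ

theorem Invariant.univ : D.Invariant fun _ => True := ⟨fun _ => Iff.rfl, fun _ => Iff.rfl⟩

/-- A labelling satisfies one half of Euler's formula. -/
theorem IsLabelling.card_region_le [Finite S] [Finite R] (hL : D.IsLabelling) {χ : R → Bool}
    (hχ : D.IsCheckerboard χ) :
    Nat.card R ≤ 1 + Nat.card D.Component + Nat.card D.Crossing := by
  have hP : D.Invariant fun _ => True := Invariant.univ
  have h1 := hP.genus_le χ
  have h2 := hP.not.genus_le χ
  have h3 := hL.card_region_add_card_component_le hχ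
  rw [hP.card_stateCircle, hP.card_stateCircle] at h3
  have h4 := hP.card_component
  have h5 := D.card_crossing fun _ => True
  omega

section planar

variable [Finite S] [Finite R] (hD : D.IsPlanar) {χ : R → Bool} (hχ : D.IsCheckerboard χ)
include hD hχ

/-- The genus inequalities for `P` and its complement add up to an upper bound for the number of
circles that, by Euler's formula, equals the lower bound from connectedness. Hence neither can be
strict. -/
theorem IsPlanar.genus_eq {P : S → Prop} (hP : D.Invariant P) :
    D.numCirclesOn (Crossing.etaU χ) P + D.numCirclesOn (Crossing.etaU fun X => !χ X) P =
      D.numCrossingsOn P + 2 * D.numComponentsOn P ∧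
    D.numCirclesOn (Crossing.etaU χ) (fun s => ¬ P s) +
      D.numCirclesOn (Crossing.etaU fun X => !χ X) (fun s => ¬ P s) =
      D.numCrossingsOn (fun s => ¬ P s) + 2 * D.numComponentsOn fun s => ¬ P s := by
  have h1 := hP.genus_le χ
  have h2 := hP.not.genus_le χ
  have h3 := hD.isLabelling.card_region_add_card_component_le hχ
  rw [hP.card_stateCircle, hP.card_stateCircle] at h3
  have h4 := hP.card_component
  have h5 := D.card_crossing P
  have h6 := D.euler_iff.1 hD.euler
  omega

theorem IsPlanar.card_circles :
    Nat.card (D.StateCircle (Crossing.etaU χ)) +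
      Nat.card (D.StateCircle (Crossing.etaU fun X => !χ X)) =
      Nat.card D.Crossing + 2 * Nat.card D.Component := by
  have hP : D.Invariant fun _ => True := Invariant.univ
  have h := hD.genus_eq hχ hP
  rw [hP.card_stateCircle, hP.card_stateCircle, hP.card_component, D.card_crossing fun _ => True]
  omega

theorem IsPlanar.incidence_surjective :
    Function.Surjective (hD.isLabelling.incidence hχ) := by
  apply IsLabelling.incidence_surjective
  have h1 := hD.card_circles hχ
  have h2 := D.euler_iff.1 hD.euler
  omega

end planar

/-! ### The signature of the Goeritz matrix -/

open Classical in
/-- Extension by zero of functions on the white regions other than `X₀`. -/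
noncomputable def extendWhite {χ : R → Bool} (X₀ : White χ) :
    ({X : White χ // X ≠ X₀} → ℝ) →ₗ[ℝ] (White χ → ℝ) where
  toFun x X := if h : X ≠ X₀ then x ⟨X, h⟩ else 0
  map_add' x y := by ext X; by_cases h : X = X₀ <;> simp [h]
  map_smul' k x := by ext X; by_cases h : X = X₀ <;> simp [h]

theorem extendWhite_val {χ : R → Bool} (X₀ : White χ) (x : {X : White χ // X ≠ X₀} → ℝ)
    (X : {X : White χ // X ≠ X₀}) : extendWhite X₀ x X.1 = x X := dif_pos X.2

theorem extendWhite_base {χ : R → Bool} (X₀ : White χ) (x : {X : White χ // X ≠ X₀} → ℝ) :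
    extendWhite X₀ x X₀ = 0 := dif_neg (not_not.2 rfl)

/-- Values may be normalized to vanish at `X₀`. -/
theorem IsCheckerboard.range_edgeMap_extendWhite {χ : R → Bool} (hχ : D.IsCheckerboard χ)
    (X₀ : White χ) :
    LinearMap.range (hχ.edgeMap ∘ₗ extendWhite X₀) = LinearMap.range hχ.edgeMap := by
  apply le_antisymm (LinearMap.range_comp_le_range _ _)
  rintro _ ⟨x, rfl⟩
  refine ⟨fun X => x X.1 - x X₀, ?_⟩
  have h : ∀ X, extendWhite X₀ (fun X => x X.1 - x X₀) X = x X - x X₀ := by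
    intro X
    by_cases hX : X = X₀
    · rw [hX, extendWhite_base, sub_self]
    · exact extendWhite_val X₀ _ ⟨X, hX⟩
  funext c
  rw [LinearMap.comp_apply, hχ.edgeMap_apply, hχ.edgeMap_apply, h, h, sub_sub_sub_cancel_right]

section signature

variable {χ : R → Bool} (hχ : D.IsCheckerboard χ) (X₀ : White χ)

-- Deleting the row and column of `X₀` amounts to restricting the form to potentials that vanish
-- there.
open Classical in
theorem IsLabelling.goeritz_form [Finite S] [Finite R] (hL : D.IsLabelling)
    (x : {X : White χ // X ≠ X₀} → ℝ) :
    ((D.goeritz χ X₀).map (Int.cast : ℤ → ℝ)).toQuadraticForm' x =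
      ∑ c : D.Crossing, (c.etaU χ : ℝ) * hχ.edgeMap (extendWhite X₀ x) c ^ 2 := by
  rw [← hL.unreducedGoeritz_form hχ]
  have hsum : ∀ f : White χ → ℝ, f X₀ = 0 →
      ∑ X, f X = ∑ X : {X : White χ // X ≠ X₀}, f X.1 := by
    intro f hf
    rw [← Finset.add_sum_erase _ _ (Finset.mem_univ X₀), hf, zero_add]
    exact Finset.sum_subtype _ (by simp) _
  have h1 : ∀ X : White χ, ∑ Y, extendWhite X₀ x X * (D.unreducedGoeritz χ X Y : ℝ) *
      extendWhite X₀ x Y = ∑ Y : {X : White χ // X ≠ X₀},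
        extendWhite X₀ x X * (D.unreducedGoeritz χ X Y.1 : ℝ) * x Y := by
    intro X
    rw [hsum _ (by rw [extendWhite_base, mul_zero])]
    simp only [extendWhite_val]
  simp only [h1]
  rw [hsum _ (by simp only [extendWhite_base, zero_mul, Finset.sum_const_zero])]
  simp only [extendWhite_val, Matrix.toQuadraticForm', LinearMap.BilinMap.toQuadraticMap_apply,
    Matrix.toLinearMap₂'_apply']
  simp only [dotProduct, Matrix.mulVec, Finset.mul_sum]
  refine Finset.sum_congr rfl fun X _ => Finset.sum_congr rfl fun Y _ => ?_
  simp only [Matrix.map_apply, goeritz, Matrix.submatrix_apply]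
  ring

/-- A union of components on which the incidence numbers are `1`, and off which they are `-1`. -/
structure IsPolarization (D : LinkDiagram S R) (χ : R → Bool) (P : S → Prop) : Prop extends
    D.Invariant P where
  eta : ∀ c : D.Crossing, P c.o ↔ c.etaU χ = 1

-- The ranks on `P` and off `P` are bounded above by circles minus components, and the total rank is
-- bounded below by the sum of these numbers. The criterion for signed sums of squares then gives
-- both indices.
open Classical in
include hχ in
theorem IsPlanar.intSignature_goeritz [Finite S] [Finite R] (hD : D.IsPlanar) {P : S → Prop}
    (hP : D.IsPolarization χ P) :
    (D.goeritz χ X₀).intSignature =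
      ((D.numCirclesOn (Crossing.etaU χ) P : ℤ) - D.numComponentsOn P) -
      ((D.numCirclesOn (Crossing.etaU χ) fun s => ¬ P s) - D.numComponentsOn fun s => ¬ P s) := by
  have hL := hD.isLabelling
  set d := hχ.edgeMap ∘ₗ extendWhite X₀ with hd
  have hQ : ∀ x, ((D.goeritz χ X₀).map (Int.cast : ℤ → ℝ)).toQuadraticForm' x =
      ∑ c : D.Crossing, if P c.o then d x c ^ 2 else - d x c ^ 2 := by
    intro x
    rw [hL.goeritz_form hχ]
    refine Finset.sum_congr rfl fun c _ => ?_
    by_cases h : P c.o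
    · rw [if_pos h, (hP.eta c).1 h]
      simp [hd]
    · rw [if_neg h, (Int.units_eq_one_or _).resolve_left fun h' => h ((hP.eta c).2 h')]
      simp [hd]
  have hcoord : ∀ p : D.Crossing → Prop, finrank ℝ (LinearMap.range (d.coordsOn p)) ≤
      finrank ℝ (LinearMap.range (hχ.edgeMap.coordsOn p)) := fun p =>
    Submodule.finrank_mono (LinearMap.range_comp_le_range (extendWhite X₀) (hχ.edgeMap.coordsOn p))
  have h1 : _ + D.numComponentsOn P ≤ D.numCirclesOn (Crossing.etaU χ) P :=
    hP.toInvariant.finrank_range_edgeMap_le hχ hL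
  have h2 : _ + D.numComponentsOn (fun s => ¬ P s) ≤
      D.numCirclesOn (Crossing.etaU χ) fun s => ¬ P s :=
    hP.toInvariant.not.finrank_range_edgeMap_le hχ hL
  have h3 := hL.le_finrank_range_edgeMap hχ (hD.incidence_surjective hχ)
  rw [hP.toInvariant.card_stateCircle, hP.toInvariant.card_component,
    ← hχ.range_edgeMap_extendWhite X₀, ← hd] at h3
  have h4 := hcoord fun c => P c.o
  have h5 := hcoord fun c => ¬ P c.o
  -- The natural-number subtraction is not truncated: by `h1` there are at least as many circles as
  -- components.
  have ha : finrank ℝ (LinearMap.range (d.coordsOn fun c => P c.o)) ≤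
    D.numCirclesOn (Crossing.etaU χ) P - D.numComponentsOn P := by omega
  have hb : finrank ℝ (LinearMap.range (d.coordsOn fun c => ¬ P c.o)) ≤
    (D.numCirclesOn (Crossing.etaU χ) fun s => ¬ P s) - D.numComponentsOn fun s => ¬ P s := by
    omega
  have e1 := sigPos_eq_of_sum_squares d (fun c => P c.o) _ hQ ha hb (by omega)
  have e2 := sigNeg_eq_of_sum_squares d (fun c => P c.o) _ hQ ha hb (by omega)
  have hs : (D.goeritz χ X₀).intSignature =
      (sigPos ((D.goeritz χ X₀).map (Int.cast : ℤ → ℝ)).toQuadraticForm' : ℤ) -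
        (sigNeg ((D.goeritz χ X₀).map (Int.cast : ℤ → ℝ)).toQuadraticForm' : ℤ) := by
    rw [Matrix.intSignature]
    congr!
  rw [hs, e1, e2]
  omega

-- At a crossing of type II the incidence number equals the sign, at any other it is opposite, so η
-- + sgn is 2η or 0.
include hχ in
theorem IsLabelling.two_mul_mu [Finite S] (hL : D.IsLabelling) :
    2 * D.mu χ = ∑ c : D.Crossing, (c.etaU χ : ℤ) + D.writhe := by
  rw [mu, writhe, Finset.mul_sum, ← Finset.sum_add_distrib]
  refine Finset.sum_congr rfl fun c _ => ?_
  rw [← c.coe_etaU hL hχ, Crossing.IsTypeII]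
  split_ifs with h
  · rw [(c.etaU_eq_sgn_iff χ).2 h]; ring
  · simp [Crossing.etaU, h]

theorem IsPolarization.sum_eta [Finite S] {P : S → Prop} (hP : D.IsPolarization χ P) :
    ∑ c : D.Crossing, (c.etaU χ : ℤ) =
      D.numCrossingsOn P - D.numCrossingsOn fun s => ¬ P s := by
  classical
  have h : ∀ c : D.Crossing, (c.etaU χ : ℤ) =
      (if P c.o then 1 else 0) - (if ¬ P c.o then 1 else 0) := by
    intro c
    by_cases h : P c.o
    · simp [(hP.eta c).1 h, h]
    · simp [(Int.units_eq_one_or _).resolve_left fun h' => h ((hP.eta c).2 h'), h]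
  simp only [h, Finset.sum_sub_distrib, Finset.sum_boole, numCrossingsOn,
    Nat.card_eq_fintype_card, Fintype.card_subtype]

/-- The state joining the black regions has only positive markers on `P` and only negative ones off
`P`, so the extreme states are obtained by exchanging the two checkerboard states off `P`. -/
theorem IsPolarization.card_plus_minus [Finite S] {P : S → Prop} (hP : D.IsPolarization χ P) :
    D.numPlusCircles = D.numCirclesOn (Crossing.etaU χ) P +
      D.numCirclesOn (Crossing.etaU fun X => !χ X) (fun s => ¬ P s) ∧
    D.numMinusCircles = D.numCirclesOn (Crossing.etaU fun X => !χ X) P +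
      D.numCirclesOn (Crossing.etaU χ) (fun s => ¬ P s) := by
  have hI := hP.toInvariant
  have hpos : ∀ c : D.Crossing, P c.o → c.etaU χ = 1 := fun c => (hP.eta c).1
  have hneg : ∀ c : D.Crossing, ¬ P c.o → c.etaU χ = -1 := fun c h =>
    (Int.units_eq_one_or _).resolve_left fun h' => h ((hP.eta c).2 h')
  constructor
  · rw [numPlusCircles, hI.card_stateCircle]
    congr 1
    · exact hI.numCirclesOn_congr fun c h => (hpos c h).symm
    · exact hI.not.numCirclesOn_congr fun c h => by rw [c.etaU_not, hneg c h, neg_neg]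
  · rw [numMinusCircles, hI.card_stateCircle]
    congr 1
    · exact hI.numCirclesOn_congr fun c h => by rw [c.etaU_not, hpos c h]
    · exact hI.not.numCirclesOn_congr fun c h => (hneg c h).symm

include hχ in
/-- The signature of a polarized diagram in terms of its extreme states. -/
theorem IsPlanar.two_mul_signature [Finite S] [Finite R] (hD : D.IsPlanar) {P : S → Prop}
    (hP : D.IsPolarization χ P) :
    2 * D.signature χ X₀ = - D.writhe + D.numPlusCircles - D.numMinusCircles := by
  have h1 := hD.intSignature_goeritz hχ X₀ hP
  have h2 := hD.isLabelling.two_mul_mu hχ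
  have h3 := hP.sum_eta
  have h4 := hP.card_plus_minus
  have h5 := hD.genus_eq hχ hP.toInvariant
  rw [signature]
  -- The two equalities `h5` eliminate the numbers of components; the difference of the crossing
  -- numbers on and off `P` then cancels against twice `mu`.
  omega

include hχ in
theorem IsPlanar.card_plus_add_card_minus [Finite S] [Finite R] (hD : D.IsPlanar) {P : S → Prop}
    (hP : D.IsPolarization χ P) :
    D.numPlusCircles + D.numMinusCircles = Nat.card D.Crossing + 2 * Nat.card D.Component := by
  have h4 := hP.card_plus_minus
  have h5 := hD.genus_eq hχ hP.toInvariant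
  rw [hP.toInvariant.card_component, D.card_crossing P]
  omega

end signature

end LinkDiagram

namespace LinkDiagram

variable {S R : Type*} {D : LinkDiagram S R}

/-! ### Alternating diagrams are polarized -/

/-- The last crossing passed before (or at) `s` has incidence number `1`. -/
def AfterPositive (D : LinkDiagram S R) (χ : R → Bool) (s : S) : Prop :=
  ∃ (t : S) (n : ℕ), (D.next ^ n) t = s ∧ D.mate t ≠ t ∧ χ (D.left t) = D.isOver t ∧
    ∀ k, 0 < k → k ≤ n → D.mate ((D.next ^ k) t) = (D.next ^ k) t

theorem afterPositive_iff {χ : R → Bool} {s : S} (hs : D.mate s ≠ s) :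
    D.AfterPositive χ s ↔ χ (D.left s) = D.isOver s := by
  constructor
  · rintro ⟨t, n, rfl, ht, hE, hk⟩
    rcases Nat.eq_zero_or_pos n with rfl | hn
    · exact hE
    · exact absurd (hk n hn le_rfl) hs
  · exact fun h => ⟨s, 0, rfl, hs, h, fun k h1 h2 => by omega⟩

theorem IsLabelling.left_next_pow (hL : D.IsLabelling) {t : S} {n : ℕ}
    (h : ∀ k, 0 < k → k ≤ n → D.mate ((D.next ^ k) t) = (D.next ^ k) t) :
    D.left ((D.next ^ n) t) = D.left t := by
  induction n with
  | zero => rfl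
  | succ n ih =>
    rw [← hL.point_left _ (h (n + 1) n.succ_pos le_rfl), pow_succ', Equiv.Perm.mul_apply,
      D.inArc_next]
    exact ih fun k h1 h2 => h k h1 (by omega)

/-- At each crossing of the strand both the color on the left and the over/under information change,
so their agreement persists; plain points change neither. -/
theorem IsAlternating.afterPositive_next (halt : D.IsAlternating) (hL : D.IsLabelling)
    {χ : R → Bool} (hχ : D.IsCheckerboard χ) {s : S} (h : D.AfterPositive χ s) :
    D.AfterPositive χ (D.next s) := by
  obtain ⟨t, n, rfl, ht, hE, hk⟩ := h
  have hpow : D.next ((D.next ^ n) t) = (D.next ^ (n + 1)) t := by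
    rw [pow_succ', Equiv.Perm.mul_apply]
  by_cases hs : D.mate (D.next ((D.next ^ n) t)) = D.next ((D.next ^ n) t)
  · refine ⟨t, n + 1, hpow.symm, ht, hE, fun k h1 h2 => ?_⟩
    rcases Nat.lt_or_ge k (n + 1) with h3 | h3
    · exact hk k h1 (by omega)
    · rwa [show k = n + 1 by omega, ← hpow]
  · rw [afterPositive_iff hs]
    have h1 := halt t (n + 1) n.succ_pos ht (fun k h1 h2 => hk k h1 (by omega))
      (by rwa [← hpow])
    rw [← hpow] at h1
    have h2 := color_left_inArc hL hχ hs
    rw [D.inArc_next, hL.left_next_pow hk, hE] at h2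
    revert h1 h2
    cases D.isOver (D.next ((D.next ^ n) t)) <;> cases D.isOver t <;>
      cases χ (D.left (D.next ((D.next ^ n) t))) <;> simp

theorem IsAlternating.isPolarization [Finite S] (halt : D.IsAlternating) (hL : D.IsLabelling)
    {χ : R → Bool} (hχ : D.IsCheckerboard χ) : D.IsPolarization χ (D.AfterPositive χ) where
  next s := by
    refine ⟨fun h => ?_, halt.afterPositive_next hL hχ⟩
    have hpow : ∀ n : ℕ, D.AfterPositive χ ((D.next ^ n) (D.next s)) := by
      intro n
      induction n with
      | zero => exact h
      | succ n ih =>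
        rw [pow_succ', Equiv.Perm.mul_apply]
        exact halt.afterPositive_next hL hχ ih
    -- As the permutation has finite order, going forward often enough leads back from `next s` to
    -- `s`.
    have h1 := hpow (orderOf D.next - 1)
    rw [← Equiv.Perm.mul_apply, ← pow_succ, Nat.sub_add_cancel (orderOf_pos D.next),
      pow_orderOf_eq_one] at h1
    exact h1
  mate s := by
    by_cases hs : D.mate s = s
    · rw [hs]
    · have hs' : D.mate (D.mate s) ≠ D.mate s := by
        rw [D.mate_mate]
        exact fun h => hs h.symm
      rw [afterPositive_iff hs, afterPositive_iff hs', D.isOver_mate s hs]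
      have key : χ (D.left (D.mate s)) = !χ (D.left s) := by
        obtain ⟨c, ⟨h1, h2⟩ | ⟨h1, h2⟩⟩ := exists_crossing hs
        · rw [h2, h1, c.color_left_u hL hχ]
        · rw [h2, h1, c.color_left_u hL hχ, Bool.not_not]
      rw [key, Bool.not_inj_iff]
  eta c := by
    rw [afterPositive_iff (s := c.o) c.2.1, ← c.color_left_o hL hχ]
    exact Eq.congr_right c.2.2

/-! ### Standard shadings of connected diagrams -/

theorem IsStandardShading.etaU {κ : R → Bool} (hκ : D.IsStandardShading κ) (hL : D.IsLabelling) :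
    (Crossing.etaU κ : D.Crossing → ℤˣ) = fun _ => 1 := by
  funext c
  have h := c.coe_etaU hL hκ.1
  rw [Crossing.eta, if_pos (hκ.2 c)] at h
  exact Units.ext h

/-- Each white region is bounded by at least one circle; a region that is not a disk may have
several. -/
theorem IsLabelling.card_white_le [Finite S] (hL : D.IsLabelling) {χ : R → Bool}
    (hχ : D.IsCheckerboard χ) :
    Nat.card (White χ) ≤ Nat.card (D.StateCircle (Crossing.etaU χ)) := by
  refine Nat.card_le_card_of_surjective (hL.circleRegion hχ) fun X => ?_
  obtain ⟨s, rfl⟩ := hχ.whiteSide_surjective hL X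
  exact ⟨Quot.mk _ s, rfl⟩

theorem card_white_add_card_black [Finite R] (χ : R → Bool) :
    Nat.card (White χ) + Nat.card (Black χ) = Nat.card R := by
  classical
  have h1 : Finite (Black χ) := Subtype.finite (p := fun X => χ X = true)
  rw [← Nat.card_sum]
  have h2 : Nat.card (Black χ) = Nat.card {X : R // ¬ χ X = false} :=
    Nat.card_congr (Equiv.subtypeEquivRight fun X => by simp)
  rw [Nat.card_sum, h2]
  change Nat.card {X : R // χ X = false} + _ = _
  rw [← Nat.card_sum]
  exact Nat.card_congr (Equiv.sumCompl _)

theorem card_black (χ : R → Bool) : Nat.card (Black χ) = Nat.card (White fun X => !χ X) :=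
  Nat.card_congr (Equiv.subtypeEquivRight fun X => by simp)

/-- The extreme states of a connected diagram count the regions of a standard shading. -/
theorem IsStandardShading.card_white_black [Finite S] [Finite R] {κ : R → Bool}
    (hκ : D.IsStandardShading κ) (hD : D.IsPlanar) (hconn : D.Connected) :
    Nat.card (White κ) = D.numPlusCircles ∧ Nat.card (Black κ) = D.numMinusCircles := by
  have h1 := hκ.etaU hD.isLabelling
  have h2 : (Crossing.etaU (fun X => !κ X) : D.Crossing → ℤˣ) = fun _ => -1 := by
    funext c
    rw [c.etaU_not, congrFun h1 c]
  have h3 := hD.isLabelling.card_white_le hκ.1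
  have h4 := hD.isLabelling.card_white_le hκ.1.not
  have h5 := hD.card_circles hκ.1
  rw [h1] at h3 h5
  rw [h2] at h4 h5
  have h6 := D.euler_iff.1 hD.euler
  have h7 := card_white_add_card_black κ
  rw [← card_black] at h4
  rw [Connected] at hconn
  rw [numPlusCircles, numMinusCircles]
  -- With one component, Euler's formula and the circle count give W + B = c + 2 = |D_{s₊}| +
  -- |D_{s₋}|, so the bounds `h3` and `h4` are equalities.
  omega

/-! ### The Seifert graph -/

section seifert

variable (D) (ε : ℤˣ)

/-- Turning to the other strand at the crossings whose sign is not `ε`. -/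
def turn (s : S) : S := if D.sign s = ε then s else D.mate s

/-- Turning to the other strand at the crossings of sign `ε`. -/
def keep (s : S) : S := if D.sign s = ε then D.mate s else s

theorem turn_turn (s : S) : D.turn ε (D.turn ε s) = s := by
  by_cases h : D.sign s = ε
  · simp [turn, h]
  · simp [turn, h, D.sign_mate, D.mate_mate]

theorem keep_keep (s : S) : D.keep ε (D.keep ε s) = s := by
  by_cases h : D.sign s = ε
  · simp [keep, h, D.sign_mate, D.mate_mate]
  · simp [keep, h]

/-- The successor of a passage after all crossings whose sign is not `ε` have been smoothed
according to the orientation. -/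
def nextTurned : Equiv.Perm S :=
  D.next.trans (Function.Involutive.toPerm (D.turn ε) (D.turn_turn ε))

theorem nextTurned_symm (s : S) : (D.nextTurned ε).symm s = D.inArc (D.turn ε s) := rfl

/-- The number of connected components of the projection after all crossings whose sign is not `ε`
have been smoothed according to the orientation. -/
noncomputable def numComponentsTurned : ℕ :=
  Nat.card (Quot (componentRel (D.nextTurned ε) (D.keep ε)))

variable {D}

theorem Crossing.sign_o (c : D.Crossing) : D.sign c.o = c.sgn := rfl

theorem Crossing.sign_u (c : D.Crossing) : D.sign c.u = c.sgn := D.sign_mate c.o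

/-- Seifert circles turn at each vertex. -/
theorem seifert_inArc {K : Type*} (f : S → K)
    (hf : ∀ a b, D.Joined (fun c => c.sgn) a b → f a = f b) (s : S) :
    f (D.inArc s) = f (D.mate s) := by
  by_cases hs : D.mate s = s
  · rw [hs]
    exact hf _ _ (Joined.point _ hs)
  · obtain ⟨c, ⟨h1, h2⟩ | ⟨h1, h2⟩⟩ := exists_crossing hs
    · rw [h2, h1, ((joined_at_crossing f hf c).1 rfl).1]
    · rw [h2, h1, ((joined_at_crossing f hf c).1 rfl).2]

theorem card_crossing_sign :
    Nat.card {s // D.keep ε s ≠ s ∧ D.isOver s = true} =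
      Nat.card {c : D.Crossing // c.sgn = ε} := by
  have h : ∀ s, D.keep ε s ≠ s ↔ D.mate s ≠ s ∧ D.sign s = ε := by
    intro s
    by_cases h : D.sign s = ε <;> simp [keep, h]
  exact Nat.card_congr
    { toFun := fun s => ⟨⟨s.1, ((h s.1).1 s.2.1).1, s.2.2⟩, ((h s.1).1 s.2.1).2⟩
      invFun := fun c => ⟨c.1.1, (h _).2 ⟨c.1.2.1, c.2⟩, c.1.2.2⟩
      left_inv := fun _ => rfl
      right_inv := fun _ => rfl }

/-- A state that follows the orientation wherever the sign is not `ε` is also a state of the partly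
smoothed diagram, so its circles are cycles there. -/
theorem balanced_turned {m : D.Crossing → ℤˣ} (f : S → ZMod 2)
    (hf : ∀ a b, D.Joined m a b → f a = f b)
    (hm : ∀ c, c.sgn ≠ ε → m c = c.sgn) (s : S) :
    (D.keep ε s = s → f ((D.nextTurned ε).symm s) = f s) ∧
      f ((D.nextTurned ε).symm s) + f s +
        (f ((D.nextTurned ε).symm (D.keep ε s)) + f (D.keep ε s)) = 0 := by
  by_cases h : D.sign s = ε
  · have h1 : D.turn ε s = s := if_pos h
    have h2 : D.keep ε s = D.mate s := if_pos h
    have h3 : D.turn ε (D.mate s) = D.mate s := if_pos ((D.sign_mate s).trans h)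
    rw [h2, nextTurned_symm, nextTurned_symm, h1, h3]
    exact ⟨fun hs => hf _ _ (Joined.point m hs), balanced_of_joined f hf s⟩
  · have h1 : D.turn ε s = D.mate s := if_neg h
    have h2 : D.keep ε s = s := if_neg h
    rw [h2, nextTurned_symm, h1, CharTwo.add_self_eq_zero]
    refine ⟨fun _ => ?_, rfl⟩
    by_cases hs : D.mate s = s
    · rw [hs]
      exact hf _ _ (Joined.point m hs)
    · obtain ⟨c, ⟨h3, h4⟩ | ⟨h3, h4⟩⟩ := exists_crossing hs
      · rw [h3, c.sign_o] at h
        rw [h4, h3, ((joined_at_crossing f hf c).1 (hm c h)).2]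
      · rw [h3, c.sign_u] at h
        rw [h4, h3, ((joined_at_crossing f hf c).1 (hm c h)).1]

/-- In the diagram where the crossings of sign other than `ε` have been smoothed, the Seifert state
and the state with all markers `-ε` are opposite at the remaining crossings. The bound is the cycle
inequality for this pair. -/
theorem card_seifert_add_card_circles_le [Finite S] :
    Nat.card D.SeifertCircle + Nat.card (D.StateCircle fun _ => -ε) ≤
      Nat.card {c : D.Crossing // c.sgn = ε} + 2 * D.numComponentsTurned ε := by
  rw [← card_crossing_sign]
  have hsgn : ∀ c : D.Crossing, c.sgn ≠ ε → -ε = c.sgn := fun c h =>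
    Int.units_eq_of_ne_of_ne (units_ne_neg_self ε) (Ne.symm h)
  refine card_quot_add_card_quot_le (D.nextTurned ε) (D.keep ε) (D.keep_keep ε) _ ?_
    (D.Joined fun c => c.sgn) (D.Joined fun _ => -ε)
    (fun f hf => balanced_turned ε f hf fun _ _ => rfl)
    (fun f hf => balanced_turned ε f hf hsgn) ?_
  · intro s hs
    by_cases h : D.sign s = ε
    · have h2 : D.keep ε s = D.mate s := if_pos h
      rw [h2] at hs ⊢
      rw [D.isOver_mate s hs]
      simp
    · exact absurd (if_neg h) hs
  · rintro f ⟨hf, hf'⟩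
    have hmate : ∀ s, D.sign s = ε → f (D.mate s) = f s := fun s hs =>
      (constant_of_joined f hf hf' s (by
        rintro c (rfl | rfl)
        · rw [← hs, c.sign_o]; exact units_ne_neg_self _
        · rw [← hs, c.sign_u]; exact units_ne_neg_self _)).2
    have hin := seifert_inArc f hf
    have key : ∀ s, f ((D.nextTurned ε).symm s) = f s := by
      intro s
      rw [nextTurned_symm, hin]
      by_cases h : D.sign s = ε
      · rw [show D.turn ε s = s from if_pos h, hmate s h]
      · rw [show D.turn ε s = D.mate s from if_neg h, D.mate_mate]
    rintro a b (rfl | rfl)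
    · have := key (D.nextTurned ε a)
      rwa [Equiv.symm_apply_apply] at this
    · by_cases h : D.sign a = ε
      · rw [show D.keep ε a = D.mate a from if_pos h, hmate a h]
      · rw [show D.keep ε a = a from if_neg h]

end seifert

/-! ### Spanning forests -/

section forest

variable [Finite S]

instance : Finite D.SeifertCircle := inferInstanceAs (Finite (Quot _))

/-- The coboundary map of a subgraph of the Seifert graph. -/
def seifertMap (T : D.Crossing → Prop) : (D.SeifertCircle → ℝ) →ₗ[ℝ] ({c // T c} → ℝ) :=
  LinearMap.funLeft ℝ ℝ (fun c => c.1.end₁) - LinearMap.funLeft ℝ ℝ (fun c => c.1.end₂)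

/-- The edges of a forest have independent coboundary coordinates, and this passes to any subset of
the edges. -/
theorem IsSpanningForest.seifertMap_surjective {T : Finset D.Crossing} (hT : D.IsSpanningForest T)
    (p : D.Crossing → Prop) : Function.Surjective (seifertMap fun c => c ∈ T ∧ p c) := by
  classical
  intro h
  -- The indicator function of the piece containing the first end of `e` after removal of `e` from
  -- the whole of `T`. Since `e` is a bridge, its coboundary is 1 at `e` and 0 at all other edges.
  let g : {c // c ∈ T ∧ p c} → D.SeifertCircle → ℝ := fun e v =>
    if D.Reach {c' | c' ∈ T ∧ c' ≠ e.1} e.1.end₁ v then 1 else 0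
  have hg : ∀ e, seifertMap (fun c => c ∈ T ∧ p c) (g e) = Pi.single e 1 := by
    intro e
    funext e'
    change g e e'.1.end₁ - g e e'.1.end₂ = _
    by_cases he : e' = e
    · subst he
      rw [Pi.single_eq_same]
      simp only [g]
      have hr : D.Reach {c' | c' ∈ T ∧ c' ≠ e'.1} e'.1.end₁ e'.1.end₁ := Relation.EqvGen.refl _
      rw [if_pos hr, if_neg (hT.2 _ e'.2.1), sub_zero]
    · rw [Pi.single_eq_of_ne he, sub_eq_zero]
      have hr : D.Reach {c' | c' ∈ T ∧ c' ≠ e.1} e'.1.end₁ e'.1.end₂ :=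
        Relation.EqvGen.rel _ _ ⟨e'.1, ⟨e'.2.1, fun h => he (Subtype.ext h)⟩, rfl, rfl⟩
      have : D.Reach {c' | c' ∈ T ∧ c' ≠ e.1} e.1.end₁ e'.1.end₁ ↔
          D.Reach {c' | c' ∈ T ∧ c' ≠ e.1} e.1.end₁ e'.1.end₂ :=
        ⟨fun h => h.trans _ _ _ hr, fun h => h.trans _ _ _ (hr.symm _ _)⟩
      simp only [g, this]
  have := Fintype.ofFinite {c // c ∈ T ∧ p c}
  refine ⟨∑ e, h e • g e, ?_⟩
  rw [map_sum]
  simp only [map_smul, hg]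
  funext e
  simp [Finset.sum_apply, Pi.single_apply]

/-- The forest edges of sign `ε` impose independent conditions on functions on the Seifert circles.
Functions constant on the components of the partly smoothed diagram satisfy them all, since a
crossing of sign `ε` remains there and connects its two ends. -/
theorem IsSpanningForest.card_filter_add_le {T : Finset D.Crossing} (hT : D.IsSpanningForest T)
    (ε : ℤˣ) :
    (T.filter fun c => c.sgn = ε).card + D.numComponentsTurned ε ≤ Nat.card D.SeifertCircle := by
  classical
  let d := seifertMap (D := D) fun c => c ∈ T ∧ c.sgn = ε
  have h1 := d.finrank_range_add_finrank_ker
  rw [LinearMap.range_eq_top.2 (hT.seifertMap_surjective fun c => c.sgn = ε), finrank_top,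
    finrank_fun_eq_natCard, finrank_fun_eq_natCard] at h1
  have h2 : Nat.card {c // c ∈ T ∧ c.sgn = ε} = (T.filter fun c => c.sgn = ε).card := by
    rw [← Nat.card_eq_finsetCard]
    exact Nat.card_congr (Equiv.subtypeEquivRight fun c => by simp)
  have h3 : D.numComponentsTurned ε ≤ finrank ℝ (LinearMap.ker d) := by
    rw [numComponentsTurned, ← finrank_fun_eq_natCard]
    let C := componentRel (D.nextTurned ε) (D.keep ε)
    have hk : ∀ s, Quot.mk C s = Quot.mk C (D.keep ε s) := fun s => Quot.sound (Or.inr rfl)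
    have hn : ∀ s, Quot.mk C ((D.nextTurned ε).symm s) = Quot.mk C s :=
      fun s => Quot.sound (Or.inl (Equiv.apply_symm_apply _ _).symm)
    have hj : ∀ a b, D.Joined (fun c => c.sgn) a b → Quot.mk C a = Quot.mk C b := by
      have hm : ∀ s, Quot.mk C (D.inArc s) = Quot.mk C (D.mate s) := by
        intro s
        by_cases h : D.sign s = ε
        · rw [← show D.keep ε s = D.mate s from if_pos h, ← hk, ← hn s, nextTurned_symm,
            show D.turn ε s = s from if_pos h]
        · have h' : ¬ D.sign (D.mate s) = ε := by rwa [D.sign_mate]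
          rw [← hn (D.mate s), nextTurned_symm,
            show D.turn ε (D.mate s) = D.mate (D.mate s) from if_neg h', D.mate_mate]
      rintro a b (⟨s, hs, rfl, rfl⟩ | ⟨c, _, ⟨rfl, rfl⟩ | ⟨rfl, rfl⟩⟩ | ⟨c, hc, _⟩)
      · rw [hm, hs]
      · rw [hm, c.mate_o]
      · rw [hm, c.mate_u]
      · exact absurd rfl hc
    let φ : (Quot C → ℝ) →ₗ[ℝ] LinearMap.ker d :=
      LinearMap.codRestrict _ (LinearMap.funLeft ℝ ℝ (Quot.lift (Quot.mk C) hj)) (by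
        intro g
        rw [LinearMap.mem_ker]
        funext c
        refine sub_eq_zero.2 (congrArg g ?_)
        change Quot.mk C c.1.o = Quot.mk C c.1.u
        rw [hk c.1.o, show D.keep ε c.1.o = c.1.u from if_pos c.2.2])
    refine LinearMap.finrank_le_finrank_of_injective (f := φ) fun g g' h => ?_
    funext q
    obtain ⟨s, rfl⟩ := Quot.exists_rep q
    exact congrFun (congrArg Subtype.val h) (Quot.mk _ s)
  omega

/-- A function on the Seifert circles without differences along `T` has none along any crossing,
hence is constant on the components of the projection. -/
theorem IsSpanningForest.card_seifert_le {T : Finset D.Crossing} (hT : D.IsSpanningForest T) :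
    Nat.card D.SeifertCircle ≤ T.card + Nat.card D.Component := by
  let d := seifertMap (D := D) fun c => c ∈ T
  have h1 := d.finrank_range_add_finrank_ker
  have h2 := Submodule.finrank_le (LinearMap.range d)
  rw [finrank_fun_eq_natCard] at h1 h2
  have h3 : Nat.card {c // c ∈ T} = T.card := by simp
  have h4 : finrank ℝ (LinearMap.ker d) ≤ Nat.card D.Component := by
    refine le_of_le_of_eq ?_ (finrank_compatible ℝ (componentRel D.next D.mate))
    let φ : LinearMap.ker d →ₗ[ℝ] compatible ℝ (componentRel D.next D.mate) :=
      LinearMap.codRestrict _ (LinearMap.funLeft ℝ ℝ (Quot.mk _) ∘ₗ Submodule.subtype _) (by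
        rintro ⟨g, hg⟩
        have hreach : ∀ v w, D.Reach (T : Set D.Crossing) v w → g v = g w := by
          intro v w h
          induction h with
          | rel v w h =>
            obtain ⟨c, hc, rfl, rfl⟩ := h
            exact sub_eq_zero.1 (congrFun (LinearMap.mem_ker.1 hg) ⟨c, hc⟩)
          | refl v => rfl
          | symm v w _ ih => exact ih.symm
          | trans u v w _ _ ih ih' => exact ih.trans ih'
        have hedge : ∀ c : D.Crossing, g c.end₁ = g c.end₂ := fun c =>
          hreach _ _ (hT.1 _ _ (Relation.EqvGen.rel _ _ ⟨c, trivial, rfl, rfl⟩))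
        have hmate : ∀ s, g (Quot.mk _ (D.mate s)) = g (Quot.mk _ s) := by
          intro s
          by_cases hs : D.mate s = s
          · rw [hs]
          · obtain ⟨c, ⟨h1, h2⟩ | ⟨h1, h2⟩⟩ := exists_crossing hs
            · rw [h2, h1]; exact (hedge c).symm
            · rw [h2, h1]; exact hedge c
        have hin : ∀ s, g (Quot.mk _ (D.inArc s)) = g (Quot.mk _ (D.mate s)) :=
          seifert_inArc (fun s => g (Quot.mk _ s)) fun a b h => congrArg g (Quot.sound h)
        rintro a b (rfl | rfl)
        · have := hin (D.next a)
          rw [D.inArc_next, hmate] at this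
          exact this
        · exact (hmate a).symm)
    refine LinearMap.finrank_le_finrank_of_injective (f := φ) fun g g' h => ?_
    apply Subtype.ext
    funext q
    obtain ⟨s, rfl⟩ := Quot.exists_rep q
    exact congrFun (congrArg Subtype.val h) s
  omega

end forest

end LinkDiagram

namespace LinkDiagram

variable {S R : Type*} {D : LinkDiagram S R}

/-! ### Signs of crossings -/

theorem card_crossing_eq_sum_signs [Finite S] :
    Nat.card D.Crossing =
      Nat.card {c : D.Crossing // c.sgn = 1} + Nat.card {c : D.Crossing // c.sgn = -1} := by
  classical
  have h : Nat.card {c : D.Crossing // c.sgn = -1} = Nat.card {c : D.Crossing // ¬ c.sgn = 1} :=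
    Nat.card_congr (Equiv.subtypeEquivRight fun c => by
      rcases Int.units_eq_one_or c.sgn with h | h <;> simp [h])
  rw [h, ← Nat.card_sum]
  exact (Nat.card_congr (Equiv.sumCompl _)).symm

theorem writhe_eq [Finite S] :
    D.writhe =
      Nat.card {c : D.Crossing // c.sgn = 1} - Nat.card {c : D.Crossing // c.sgn = -1} := by
  classical
  have h : ∀ c : D.Crossing, (c.sgn : ℤ) =
      (if c.sgn = 1 then 1 else 0) - (if c.sgn = -1 then 1 else 0) := by
    intro c
    rcases Int.units_eq_one_or c.sgn with h | h <;> simp [h]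
  simp only [writhe, h, Finset.sum_sub_distrib, Finset.sum_boole, Nat.card_eq_fintype_card,
    Fintype.card_subtype]

theorem dPlus_add_dMinus (T : Finset D.Crossing) : D.dPlus T + D.dMinus T = T.card := by
  classical
  have h : T.filter (fun c => c.sgn = -1) = T.filter fun c => ¬ c.sgn = 1 :=
    Finset.filter_congr fun c _ => by
      rcases Int.units_eq_one_or c.sgn with h | h <;> simp [h]
  rw [dPlus, dMinus, h, Finset.card_filter_add_card_filter_not]

/-! ### Smoothing a crossing -/

section smooth

variable {p : D.Crossing}

theorem smooth_mate_of_ne {s : S} (ho : s ≠ p.o) (hu : s ≠ p.u) :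
    (D.smooth p).mate s = D.mate s := if_neg (by tauto)

theorem smooth_mate_eq_iff {s : S} :
    (D.smooth p).mate s = s ↔ s = p.o ∨ s = p.u ∨ D.mate s = s := by
  by_cases h : s = p.o ∨ s = p.u
  · have : (D.smooth p).mate s = s := if_pos h
    tauto
  · have : (D.smooth p).mate s = D.mate s := if_neg h
    rw [this]
    tauto

theorem smooth_inArc_o : (D.smooth p).inArc p.o = D.inArc p.u := by
  classical
  change D.next.symm (Equiv.swap p.o p.u p.o) = _
  rw [Equiv.swap_apply_left]
  rfl

theorem smooth_inArc_u : (D.smooth p).inArc p.u = D.inArc p.o := by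
  classical
  change D.next.symm (Equiv.swap p.o p.u p.u) = _
  rw [Equiv.swap_apply_right]
  rfl

theorem smooth_inArc_of_ne {s : S} (ho : s ≠ p.o) (hu : s ≠ p.u) :
    (D.smooth p).inArc s = D.inArc s := by
  classical
  change D.next.symm (Equiv.swap p.o p.u s) = _
  rw [Equiv.swap_apply_of_ne_of_ne ho hu]
  rfl

/-- The crossings of the smoothed diagram are crossings of the original diagram. -/
def ofSmooth (c : (D.smooth p).Crossing) : D.Crossing :=
  ⟨c.1, fun h => c.2.1 (smooth_mate_eq_iff.2 (Or.inr (Or.inr h))), c.2.2⟩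

theorem ofSmooth_o (c : (D.smooth p).Crossing) : (ofSmooth c).o = c.o := rfl

theorem ofSmooth_sgn (c : (D.smooth p).Crossing) : (ofSmooth c).sgn = c.sgn := rfl

theorem smooth_ne (c : (D.smooth p).Crossing) :
    c.o ≠ p.o ∧ c.o ≠ p.u ∧ D.mate c.o ≠ c.o := by
  have h := c.2.1
  rw [Ne, smooth_mate_eq_iff] at h
  exact ⟨fun e => h (Or.inl e), fun e => h (Or.inr (Or.inl e)),
    fun e => h (Or.inr (Or.inr e))⟩

theorem ofSmooth_u (c : (D.smooth p).Crossing) : (ofSmooth c).u = c.u :=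
  (smooth_mate_of_ne (smooth_ne c).1 (smooth_ne c).2.1).symm

theorem smooth_u_ne (c : (D.smooth p).Crossing) : c.u ≠ p.o ∧ c.u ≠ p.u := by
  rw [← ofSmooth_u c]
  have h := (smooth_ne c)
  constructor
  · intro e
    apply h.2.1
    rw [← ofSmooth_o c, ← (ofSmooth c).mate_u, e, p.mate_o]
  · intro e
    apply h.1
    rw [← ofSmooth_o c, ← (ofSmooth c).mate_u, e, p.mate_u]

theorem ofSmooth_rise (c : (D.smooth p).Crossing) : (ofSmooth c).rise = c.rise := by
  rw [Crossing.rise, Crossing.rise, ofSmooth_o c, ofSmooth_u c, ofSmooth_sgn c]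

theorem ofSmooth_fall (c : (D.smooth p).Crossing) : (ofSmooth c).fall = c.fall := by
  rw [Crossing.fall, Crossing.fall, ofSmooth_o c, ofSmooth_u c, ofSmooth_sgn c]

theorem inArc_rise_ofSmooth (c : (D.smooth p).Crossing) :
    (D.smooth p).inArc c.rise = D.inArc (ofSmooth c).rise := by
  rw [ofSmooth_rise c]
  rcases c.rise_fall with ⟨_, h, _⟩ | ⟨_, h, _⟩ <;> rw [h]
  · exact smooth_inArc_of_ne (smooth_ne c).1 (smooth_ne c).2.1
  · exact smooth_inArc_of_ne (smooth_u_ne c).1 (smooth_u_ne c).2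

theorem inArc_fall_ofSmooth (c : (D.smooth p).Crossing) :
    (D.smooth p).inArc c.fall = D.inArc (ofSmooth c).fall := by
  rw [ofSmooth_fall c]
  rcases c.rise_fall with ⟨_, _, h⟩ | ⟨_, _, h⟩ <;> rw [h]
  · exact smooth_inArc_of_ne (smooth_u_ne c).1 (smooth_u_ne c).2
  · exact smooth_inArc_of_ne (smooth_ne c).1 (smooth_ne c).2.1

theorem smooth_north (c : (D.smooth p).Crossing) :
    c.north = Quot.mk _ (ofSmooth c).north := by
  change (D.smooth p).left c.rise = _
  rw [← ofSmooth_rise c]; rfl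

theorem smooth_west (c : (D.smooth p).Crossing) :
    c.west = Quot.mk _ (ofSmooth c).west := by
  rw [Crossing.west, ← ofSmooth_fall c]; rfl

theorem smooth_east (c : (D.smooth p).Crossing) :
    c.east = Quot.mk _ (ofSmooth c).east := by
  rw [Crossing.east, ← ofSmooth_rise c]; rfl

theorem smooth_south (c : (D.smooth p).Crossing) :
    c.south = Quot.mk _ (ofSmooth c).south := by
  change (D.smooth p).right ((D.smooth p).inArc c.rise) = _
  rw [inArc_rise_ofSmooth c]; rfl

theorem smooth_inArc_rise : (D.smooth p).inArc p.rise = D.inArc p.fall := by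
  rcases p.rise_fall with ⟨_, h, h'⟩ | ⟨_, h, h'⟩ <;> rw [h, h']
  exacts [smooth_inArc_o, smooth_inArc_u]

theorem smooth_inArc_fall : (D.smooth p).inArc p.fall = D.inArc p.rise := by
  rcases p.rise_fall with ⟨_, h, h'⟩ | ⟨_, h, h'⟩ <;> rw [h, h']
  exacts [smooth_inArc_u, smooth_inArc_o]

theorem smooth_mate_eq_iff' {s : S} :
    (D.smooth p).mate s = s ↔
      s = p.rise ∨ s = p.fall ∨ (s ≠ p.o ∧ s ≠ p.u ∧ D.mate s = s) := by
  rw [smooth_mate_eq_iff]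
  rcases p.rise_fall with ⟨_, h, h'⟩ | ⟨_, h, h'⟩ <;> rw [h, h'] <;> tauto

theorem smooth_next (s : S) :
    (D.smooth p).next s = D.next s ∨
      (D.next s = p.o ∧ (D.smooth p).next s = p.u) ∨
      (D.next s = p.u ∧ (D.smooth p).next s = p.o) := by
  classical
  have h : (D.smooth p).next s = Equiv.swap p.o p.u (D.next s) := by
    change Equiv.swap p.o p.u (D.next s) = Equiv.swap p.o p.u (D.next s)
    congr!
  rw [h]
  by_cases h1 : D.next s = p.o
  · rw [h1, Equiv.swap_apply_left]; tauto
  · by_cases h2 : D.next s = p.u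
    · rw [h2, Equiv.swap_apply_right]; tauto
    · rw [Equiv.swap_apply_of_ne_of_ne h1 h2]; tauto

theorem IsLabelling.smooth (hL : D.IsLabelling) (p : D.Crossing) : (D.smooth p).IsLabelling where
  point_left s hs := by
    rcases smooth_mate_eq_iff'.1 hs with rfl | rfl | ⟨h1, h2, h3⟩
    · rw [smooth_inArc_rise]
      change Quot.mk _ (D.left (D.inArc p.fall)) = Quot.mk _ p.north
      rw [hL.corner_south]
      exact (Quot.sound ⟨rfl, rfl⟩).symm
    · rw [smooth_inArc_fall]
      exact congrArg (Quot.mk _) (hL.corner_west p)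
    · rw [smooth_inArc_of_ne h1 h2]
      exact congrArg (Quot.mk _) (hL.point_left s h3)
  point_right s hs := by
    rcases smooth_mate_eq_iff'.1 hs with rfl | rfl | ⟨h1, h2, h3⟩
    · rw [smooth_inArc_rise]
      exact congrArg (Quot.mk _) (hL.corner_east p)
    · rw [smooth_inArc_fall]
      change Quot.mk _ p.south = Quot.mk _ (D.right p.fall)
      rw [hL.corner_north]
      exact (Quot.sound ⟨rfl, rfl⟩).symm
    · rw [smooth_inArc_of_ne h1 h2]
      exact congrArg (Quot.mk _) (hL.point_right s h3)
  corner_north c := by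
    rw [smooth_north c, ← hL.corner_north (ofSmooth c), ← ofSmooth_fall c]; rfl
  corner_south c := by
    rw [smooth_south c, ← hL.corner_south (ofSmooth c), inArc_fall_ofSmooth c]; rfl
  corner_west c := by
    rw [smooth_west c, ← hL.corner_west, inArc_rise_ofSmooth c]; rfl
  corner_east c := by
    rw [smooth_east c, ← hL.corner_east, inArc_fall_ofSmooth c]; rfl
  surj := by
    rintro ⟨X⟩
    obtain ⟨s, hs⟩ := hL.surj X
    exact ⟨s, hs.imp (congrArg (Quot.mk _)) (congrArg (Quot.mk _))⟩
  sphere_connected s t := by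
    set r := fun a b => b = (D.smooth p).next a ∨ b = (D.smooth p).mate a ∨
      (D.smooth p).left a = (D.smooth p).left b ∨ (D.smooth p).left a = (D.smooth p).right b ∨
      (D.smooth p).right a = (D.smooth p).right b
    -- The passages at `p` are no longer mates, but the arcs leaving them still share the region to
    -- the north.
    have hrf : Relation.EqvGen r p.rise p.fall :=
      .rel _ _ (Or.inr (Or.inr (Or.inr (Or.inl (congrArg (Quot.mk _) (hL.corner_north p).symm)))))
    have hou : Relation.EqvGen r p.o p.u := by
      rcases p.rise_fall with ⟨_, h, h'⟩ | ⟨_, h, h'⟩ <;> rw [h, h'] at hrf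
      exacts [hrf, hrf.symm]
    have hnext : ∀ a, Relation.EqvGen r a (D.next a) := by
      intro a
      have h0 : Relation.EqvGen r a ((D.smooth p).next a) := .rel _ _ (Or.inl rfl)
      rcases D.smooth_next (p := p) a with h | ⟨h1, h2⟩ | ⟨h1, h2⟩
      · rwa [h] at h0
      · rw [h2] at h0; rw [h1]; exact h0.trans _ _ _ (hou.symm _ _)
      · rw [h2] at h0; rw [h1]; exact h0.trans _ _ _ hou
    have hmate : ∀ a, Relation.EqvGen r a (D.mate a) := by
      intro a
      by_cases h1 : a = p.o
      · rw [h1, p.mate_o]; exact hou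
      by_cases h2 : a = p.u
      · rw [h2, p.mate_u]; exact hou.symm _ _
      exact .rel _ _ (Or.inr (Or.inl (smooth_mate_of_ne h1 h2).symm))
    induction hL.sphere_connected s t with
    | rel a b h =>
      rcases h with rfl | rfl | h | h | h
      · exact hnext a
      · exact hmate a
      · exact .rel _ _ (Or.inr (Or.inr (Or.inl (congrArg (Quot.mk _) h))))
      · exact .rel _ _ (Or.inr (Or.inr (Or.inr (Or.inl (congrArg (Quot.mk _) h)))))
      · exact .rel _ _ (Or.inr (Or.inr (Or.inr (Or.inr (congrArg (Quot.mk _) h)))))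
    | refl a => exact .refl a
    | symm a b _ ih => exact ih.symm
    | trans a b c _ _ ih₁ ih₂ => exact ih₁.trans _ _ _ ih₂

/-- The regions of the smoothed diagram. -/
abbrev SmoothRegion (p : D.Crossing) : Type _ := Quot fun X Y : R => X = p.north ∧ Y = p.south

/-- Only north and south are identified, so sending south to `none` and every other region to its
class is injective. -/
theorem card_region_le_smooth [Finite R] (p : D.Crossing) :
    Nat.card R ≤ Nat.card (Quot fun X Y : R => X = p.north ∧ Y = p.south) + 1 := by
  classical
  let g : SmoothRegion p → R := Quot.lift (fun X => if X = p.south then p.north else X) (by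
    rintro X Y ⟨rfl, rfl⟩
    simp)
  have hinj : Function.Injective fun X : R =>
      if X = p.south then none else some (Quot.mk _ X : SmoothRegion p) := by
    intro X Y h
    by_cases hX : X = p.south <;> by_cases hY : Y = p.south
    · rw [hX, hY]
    · simp [hX, hY] at h
    · simp [hX, hY] at h
    · simp only [hX, hY, if_false, Option.some.injEq] at h
      have := congrArg g h
      simpa [g, hX, hY] using this
  have h := Nat.card_le_card_of_injective _ hinj
  rwa [Finite.card_option] at h

theorem IsCheckerboard.ofSmooth {χ : SmoothRegion p → Bool}
    (hχ : (D.smooth p).IsCheckerboard χ) : D.IsCheckerboard fun X => χ (Quot.mk _ X) := hχ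

theorem etaU_ofSmooth (χ : SmoothRegion p → Bool) (c : (D.smooth p).Crossing) :
    (ofSmooth c).etaU (fun X => χ (Quot.mk _ X)) = c.etaU χ := by
  rw [Crossing.etaU, Crossing.etaU, smooth_north c, ofSmooth_sgn c]

/-- Both passages at `p` lie on the same side of `P`, so exchanging their incoming arcs keeps `P`
invariant, and the other incidence numbers do not change. -/
theorem IsPolarization.smooth {χ : SmoothRegion p → Bool} {P : S → Prop}
    (hP : D.IsPolarization (fun X => χ (Quot.mk _ X)) P) : (D.smooth p).IsPolarization χ P where
  next s := by
    have hou : P p.u ↔ P p.o := hP.mate p.o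
    have h := hP.next s
    rcases D.smooth_next (p := p) s with h' | ⟨h1, h2⟩ | ⟨h1, h2⟩
    · rw [h', h]
    · rw [h2, hou, ← h1, h]
    · rw [h2, ← hou, ← h1, h]
  mate s := by
    by_cases hs : (D.smooth p).mate s = s
    · rw [hs]
    · rw [smooth_mate_eq_iff, not_or, not_or] at hs
      rw [smooth_mate_of_ne hs.1 hs.2.1, hP.mate]
  eta c := by
    rw [← etaU_ofSmooth χ c, ← hP.eta, ofSmooth_o c]

/-- The crossings of the smoothed diagram are the crossings of the original diagram other than the
smoothed one. -/
def smoothCrossingEquiv (p : D.Crossing) : (D.smooth p).Crossing ≃ {c : D.Crossing // c ≠ p} where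
  toFun c := ⟨ofSmooth c, fun h => (smooth_ne c).1 (congrArg Crossing.o h)⟩
  invFun c := ⟨c.1.1, by
    rw [Ne, smooth_mate_eq_iff]
    rintro (h | h | h)
    · exact c.2 (Subtype.ext h)
    · have h1 : D.isOver p.u = !D.isOver p.o := D.isOver_mate _ p.2.1
      have h2 : D.isOver p.o = true := p.2.2
      have h3 := c.1.2.2
      rw [h, h1, h2] at h3
      simp at h3
    · exact c.1.2.1 h, c.1.2.2⟩
  left_inv _ := rfl
  right_inv _ := rfl

theorem card_crossing_smooth [Finite S] (p : D.Crossing) :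
    Nat.card (D.smooth p).Crossing + 1 = Nat.card D.Crossing := by
  classical
  rw [Nat.card_congr (smoothCrossingEquiv p), Nat.card_eq_fintype_card, Nat.card_eq_fintype_card,
    Fintype.card_subtype_compl, Fintype.card_subtype_eq]
  exact Nat.sub_add_cancel (Fintype.card_pos_iff.2 ⟨p⟩)

theorem writhe_smooth [Finite S] (p : D.Crossing) :
    (D.smooth p).writhe + p.sgn = D.writhe := by
  classical
  rw [writhe, writhe, ← Finset.add_sum_erase _ _ (Finset.mem_univ p), add_comm]
  congr 1
  rw [Finset.sum_subtype (p := fun c => c ≠ p) _ (by simp)]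
  exact Fintype.sum_equiv (smoothCrossingEquiv p) _ _ fun _ => rfl

/-- Smoothing a crossing does not change the extreme state whose marker is the sign of the
crossing. -/
theorem card_stateCircle_smooth (p : D.Crossing) :
    Nat.card ((D.smooth p).StateCircle fun _ => p.sgn) =
      Nat.card (D.StateCircle fun _ => p.sgn) := by
  -- The marker at `p` prescribes exactly the smoothing already performed, and arcs keep their
  -- names, so the two relations coincide on the nose.
  have h : (D.smooth p).Joined (fun _ => p.sgn) = D.Joined fun _ => p.sgn := by
    funext a b
    refine propext ⟨?_, ?_⟩
    · rintro (⟨s, hs, rfl, rfl⟩ | ⟨c, h1, h2⟩ | ⟨c, h1, h2⟩)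
      · by_cases ho : b = p.o
        · rw [ho, smooth_inArc_o]
          exact Or.inr (Or.inl ⟨p, rfl, Or.inr ⟨rfl, rfl⟩⟩)
        by_cases hu : b = p.u
        · rw [hu, smooth_inArc_u]
          exact Or.inr (Or.inl ⟨p, rfl, Or.inl ⟨rfl, rfl⟩⟩)
        rw [smooth_inArc_of_ne ho hu]
        exact Or.inl ⟨b, by rwa [smooth_mate_of_ne ho hu] at hs, rfl, rfl⟩
      all_goals
        rw [smooth_inArc_of_ne (smooth_ne c).1 (smooth_ne c).2.1,
          smooth_inArc_of_ne (smooth_u_ne c).1 (smooth_u_ne c).2, ← ofSmooth_u c] at h2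
      · exact Or.inr (Or.inl ⟨ofSmooth c, h1, h2⟩)
      · exact Or.inr (Or.inr ⟨ofSmooth c, h1, h2⟩)
    · have hlift : ∀ c : D.Crossing, c ≠ p → ∃ c' : (D.smooth p).Crossing, ofSmooth c' = c :=
        fun c hc => ⟨(smoothCrossingEquiv p).symm ⟨c, hc⟩, rfl⟩
      rintro (⟨s, hs, rfl, rfl⟩ | ⟨c, h1, h2⟩ | ⟨c, h1, h2⟩)
      · have ho : b ≠ p.o := by rintro rfl; exact p.2.1 hs
        have hu : b ≠ p.u := by
          rintro rfl
          rw [p.mate_u] at hs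
          exact p.2.1 hs.symm
        exact Or.inl ⟨b, by rwa [smooth_mate_of_ne ho hu], (smooth_inArc_of_ne ho hu).symm, rfl⟩
      · by_cases hc : c = p
        · subst hc
          rcases h2 with ⟨rfl, rfl⟩ | ⟨rfl, rfl⟩
          · exact Or.inl ⟨c.u, if_pos (Or.inr rfl), smooth_inArc_u.symm, rfl⟩
          · exact Or.inl ⟨c.o, if_pos (Or.inl rfl), smooth_inArc_o.symm, rfl⟩
        · obtain ⟨c, rfl⟩ := hlift c hc
          rw [ofSmooth_u c, ofSmooth_o c, ← smooth_inArc_of_ne (smooth_ne c).1 (smooth_ne c).2.1,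
            ← smooth_inArc_of_ne (smooth_u_ne c).1 (smooth_u_ne c).2] at h2
          exact Or.inr (Or.inl ⟨c, h1, h2⟩)
      · obtain ⟨c, rfl⟩ := hlift c (by rintro rfl; exact h1 rfl)
        rw [ofSmooth_u c, ofSmooth_o c, ← smooth_inArc_of_ne (smooth_ne c).1 (smooth_ne c).2.1,
          ← smooth_inArc_of_ne (smooth_u_ne c).1 (smooth_u_ne c).2] at h2
        exact Or.inr (Or.inr ⟨c, h1, h2⟩)
  rw [StateCircle, StateCircle, h]

/-- Smoothing a crossing that is not nugatory gives a planar diagram with the same number of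
components of the projection. -/
theorem IsPlanar.smooth [Finite S] [Finite R] (hD : D.IsPlanar) {p : D.Crossing}
    (hp : ¬ D.IsNugatory p) {χ : SmoothRegion p → Bool} (hχ : (D.smooth p).IsCheckerboard χ) :
    (D.smooth p).IsPlanar ∧ Nat.card (D.smooth p).Component = Nat.card D.Component := by
  have hL := hD.isLabelling.smooth p
  have h1 := hL.card_region_le hχ
  have h2 := D.euler_iff.1 hD.euler
  have h3 := card_crossing_smooth p
  have h4 := card_region_le_smooth p
  rw [IsNugatory] at hp
  -- One crossing and at most one region disappear, so the labelling bound `h1` yields that the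
  -- number of components does not drop; it does not grow either, as `p` is not nugatory. Hence the
  -- bound is attained, which is Euler's formula.
  refine ⟨⟨hL.point_left, hL.point_right, hL.corner_north, hL.corner_south, hL.corner_west,
    hL.corner_east, hL.surj, hL.sphere_connected, (euler_iff _).2 ?_⟩, ?_⟩ <;> omega

end smooth

end LinkDiagram

/-! ### The signature formulas. -/

open LinkDiagram in
theorem mainTheorem2 {S R : Type*} [Finite S] [Finite R] (D : LinkDiagram S R)
    (hplanar : D.IsPlanar) (halt : D.IsAlternating) (hred : D.IsReduced)
    (χ : R → Bool) (hχ : D.IsCheckerboard χ) (X₀ : LinkDiagram.White χ) :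
    (∀ T : Finset D.Crossing, D.IsSpanningForest T →
      D.signature χ X₀ = - D.writhe + D.dPlus T - D.dMinus T) ∧
    ((D.signature χ X₀ : ℚ) =
      - (1 / 2) * ((D.writhe : ℚ) - D.numPlusCircles + D.numMinusCircles)) ∧
    (D.Connected → ∀ κ : R → Bool, D.IsStandardShading κ →
      (D.signature χ X₀ : ℚ) = - (1 / 2) * D.writhe +
        (1 / 2) * ((Nat.card (LinkDiagram.White κ) : ℚ) - Nat.card (LinkDiagram.Black κ))) ∧
    (∀ (p : D.Crossing) (χ' : (Quot fun X Y : R => X = p.north ∧ Y = p.south) → Bool),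
      (D.smooth p).IsCheckerboard χ' → ∀ X₀' : LinkDiagram.White χ',
        D.signature χ X₀ = (D.smooth p).signature χ' X₀' - p.sgn) := by
  have hL := hplanar.isLabelling
  have hP := halt.isPolarization hL hχ
  have hσ := hplanar.two_mul_signature hχ X₀ hP
  have hcirc := hplanar.card_plus_add_card_minus hχ hP
  have hσ' : (D.signature χ X₀ : ℚ) =
      - (1 / 2) * ((D.writhe : ℚ) - D.numPlusCircles + D.numMinusCircles) := by
    have : (2 * D.signature χ X₀ : ℚ) = - D.writhe + D.numPlusCircles - D.numMinusCircles := by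
      exact_mod_cast hσ
    linarith
  refine ⟨fun T hT => ?_, hσ', fun hconn κ hκ => ?_, fun p χ' hχ' X₀' => ?_⟩
  · have h1 : _ + D.numMinusCircles ≤ _ := card_seifert_add_card_circles_le (D := D) 1
    have h2 : _ + Nat.card (D.StateCircle fun _ => - -1) ≤ _ :=
      card_seifert_add_card_circles_le (D := D) (-1)
    rw [neg_neg] at h2
    change _ + D.numPlusCircles ≤ _ at h2
    have h3 : D.dPlus T + _ ≤ _ := hT.card_filter_add_le 1
    have h4 : D.dMinus T + _ ≤ _ := hT.card_filter_add_le (-1)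
    have h5 := hT.card_seifert_le
    have h6 := dPlus_add_dMinus T
    have h7 := D.card_crossing_eq_sum_signs
    have h8 := D.writhe_eq
    -- With s Seifert circles and N₊, N₋ components of the partly smoothed diagrams, `h1` to `h6`
    -- give 2s + |D_{s₊}| + |D_{s₋}| ≤ c + 2(N₊ + N₋) ≤ c + 4s - 2|T| ≤ c + 2s + 2C. By `hcirc` all
    -- are equalities, whence |D_{s₋}| = c₊ + s - 2d₊ and |D_{s₊}| = c₋ + s - 2d₋.
    omega
  · obtain ⟨h1, h2⟩ := hκ.card_white_black hplanar hconn
    rw [hσ', h1, h2]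
    ring
  · obtain ⟨hD₀, hC⟩ := hplanar.smooth (hred p) hχ'
    -- The polarization is inherited from `D` with the coloring pulled back from `χ'`, which may
    -- differ from `χ`; alternation of the smoothed diagram need not be checked.
    have hP₀ := (halt.isPolarization hL hχ'.ofSmooth).smooth
    have h1 := hD₀.two_mul_signature hχ' X₀' hP₀
    have h2 := hD₀.card_plus_add_card_minus hχ' hP₀
    have h3 := card_crossing_smooth p
    have h4 := writhe_smooth p
    have h5 := card_stateCircle_smooth p
    -- The state with marker `p.sgn` keeps its circles, while the sum c + 2C of both circle numbers
    -- drops by one; so the opposite state loses one circle.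
    rcases Int.units_eq_one_or p.sgn with hs | hs
    · rw [hs] at h4 h5 ⊢
      change (D.smooth p).numPlusCircles = D.numPlusCircles at h5
      simp only [Units.val_one] at h4 ⊢
      omega
    · rw [hs] at h4 h5 ⊢
      change (D.smooth p).numMinusCircles = D.numMinusCircles at h5
      simp only [Units.val_neg, Units.val_one] at h4 ⊢
      omega
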